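/- **Setting.** Let $I=\mathbb Z\setminus\{0,2,-2\}$. The state space is spanned by orthonormal vectors $|\{n_k\};S,S_3,S^3\rangle$, where $(n_k)_{k\in I}$ are occupation numbers (finitely many nonzero), $S\in\mathbb Z_{\ge0}$, and $S_3,S^3\in\{-S,\dots,S\}$. Let $a_k,a_k^+$ ($k\in I$) be the oscillator operators with $[a_k,a_l^+]=k\,\delta_{kl}$, $[a_k,a_l]=0$: for $k>0$, $a_k$ annihilates and $a_k^+$ creates a quantum of the mode $k$; for $k<0$, $a_k$ creates and $a_k^+$ annihilates one. Put $a_0=a_{\pm2}=0$ and $$L_0^{(2)}=\sum_{k\in I} :a_k^+a_k:\;=\sum_{k\in I}|k|n_k,\qquad A_3^{(2)}=\sum_{k\in I}\tfrac1k:a_k^+a_k:\;=\sum_{k\in I}\mathrm{sign}(k)\,n_k,$$ $$\Sigma_+=\sum_{n,k\ne0}\tfrac1n\,a_n^+a_k^+a_{n+k},\quad \Sigma_-=\Sigma_+^+,\quad d_\pm=\tfrac12a_{\pm4}^+,\quad f_\pm=\sum_{k\ne0}\Big(\tfrac1k\pm\tfrac12\Big)a_k\,a_{k\pm2}^+,$$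 $$g_+=\sum_{n+k=-2}\tfrac1n\,a_na_k,\qquad g'_-=\sum_{n+k=2,\ (n,k)\ne(1,1)}\tfrac1n\,a_na_k,$$ $$d=d_+-d_-,\qquad f=f_+-f_-,\qquad g'=g'_--g_+ .$$ All these sums are finite on every basis vector. The spin operators act by $$S_\pm|S,S_3,S^3\rangle=\sqrt{S(S+1)-S_3(S_3\mp1)}\;|S,S_3\mp1,S^3\rangle$$ ($S_+$ lowers and $S_-$ raises $S_3$). Fix real constants $c_1,c_2,c_3$ with $c_1\notin\{0,-1,-2,\dots\}$ and $c_2>0$, and put $\gamma=(L_0^{(2)}+c_2)^{-1/2}$, $\tilde n_1=a_1^+a_1+c_1$. Polynomials $P_n,b_n$ ($n\ge1$) in commuting variables $a_1,\Sigma_\pm,S_\pm,d_\pm,f_\pm,g'_-,g_+$, their conjugates (with $\Sigma_\pm^*=\Sigma_\mp$, $S_\pm^*=S_\mp$) and the real variables $\gamma,\gamma^{-1}$ are defined by $P_1=-\Sigma_++S_+/\gamma$, $b_1=0$ and, for $n>1$, $$P_n=-f^*a_1^{*2}P_{n-1}^*-g'^*a_1^2P_{n-1}-d^*a_1^{*4}\sum_{m=1}^{n-2}P_{n-m-1}^*P_m^*-\tfrac12\,d\,a_1^{*2}a_1^2\sum_{m=1}^{n-2}P_{n-m-1}P_m^*+\frac{S_+}{\gamma}b_{n-1},$$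 $$b_n=a_1^{*2}a_1^2\gamma^2\sum_{m=1}^{n-1}P_{n-m}^*P_m-\tfrac12\sum_{m=1}^{n-1}b_{n-m}b_m .$$ (These are the coefficients of $1/|a_1|^{4n}$ in the formal solution $a_2=\sum_n P_na_1^2/|a_1|^{4n}$, $\beta=\sum_n b_n/|a_1|^{4n}$ of the classical equations $a_2=\frac{a_1^2}{|a_1|^4}\big(-z+\frac{S_+}{\gamma}(1+\beta)\big)$, $\beta=a_2^*a_2\gamma^2-\beta^2/2$, $z=\Sigma_++f^*a_2^*+g'^*a_2+d^*a_2^{*2}+\tfrac12d\,a_2a_2^*$.) The operator $:P_n:$ is obtained from $P_n$, written out in monomials in these variables, by replacing the variables by operators in a fixed normal order: the factors that raise $L_0^{(2)}$ stand on the left, the neutral ones ($\Sigma_\pm,S_\pm,\gamma,\gamma^{-1}$) in the middle, those that lower $L_0^{(2)}$ on the right, and $S_+$ stands to the left of $S_-$; the relative order of the elementary operators is otherwise fixed arbitrarily. Define, through matrix elements in the basis above (each matrix element of $\alpha_2$ is a finite sum), $$\alpha_2=\sum_{n\ge1}\tilde n_1^{-2n+1}:P_n:,\qquad \frac{P^2}{2\pi}=L_0^{(2)}+2\alpha_2\alpha_2^++c_3,$$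 where $\alpha_2^+$ is the Hermitian conjugate of $\alpha_2$. **Lemma 6.** For every such ordering and every such $c_1,c_2$, each of the states $$\begin{array}{c|c|c} L_0^{(2)} & S=S_3=A_3^{(2)} & |\{n_k\}\rangle\\\hline 0&0&|0\rangle\\ 2&0&|1_1\,1_{-1}\rangle\\ 4&0&|2_1\,2_{-1}\rangle\\ 1&1&|1_1\rangle\\ 3&1&|1_3\rangle\end{array}$$ (where $m_k$ denotes $m$ quanta in the mode $k$), with any $S^3\in\{-S,\dots,S\}$, is an eigenvector of $L_0^{(2)}$, $A_3^{(2)}$, $S_3$ and $S_iS_i=S_3^2+\tfrac12(S_+S_-+S_-S_+)$ with the eigenvalues stated in the table (that of $S_iS_i$ being $S(S+1)$), and is annihilated by $\alpha_2^+$. Consequently, for $c_3=0$, $P^2/2\pi$ is defined on it, and it is an eigenvector of $P^2/2\pi$ with the integer eigenvalue $P^2/2\pi=L_0^{(2)}$, i.e. $0,2,4,1,3$ respectively. -/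

import Mathlib

open scoped BigOperators

namespace LCString

noncomputable section

/-! ### State space -/

/-- Oscillator modes that stay independent: all nonzero integers except `2` and `-2`. -/
def IsMode (k : ℤ) : Prop := k ≠ 0 ∧ k ≠ 2 ∧ k ≠ -2

/-- The type of independent oscillator modes. -/
abbrev Mode : Type := {k : ℤ // IsMode k}

/-- Occupation numbers `n_k`, finitely many of them nonzero. -/
abbrev Occ : Type := Mode →₀ ℕ

/-- Labels `(S, S_3, S^3)` of the standard basis of the quantum top with integer spin:
`low` is the lower-index projection `S_3`, `up` the upper-index projection `S^3`. -/
@[ext] structure Spin : Type where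
  S : ℕ
  low : ℤ
  up : ℤ
  hlow : |low| ≤ (S : ℤ)
  hup : |up| ≤ (S : ℤ)

/-- Labels of the orthonormal basis of the state space. -/
abbrev Basis : Type := Occ × Spin

/-- Finite linear combinations of basis states. -/
abbrev Vec : Type := Basis →₀ ℂ

/-- Operators on finite linear combinations of basis states. -/
abbrev Op : Type := Module.End ℂ Vec

/-- The basis state with label `b`. -/
def ket (b : Basis) : Vec := Finsupp.single b 1

/-- The operator with prescribed values on the basis states. -/
def ofKets (F : Basis → Vec) : Op := Finsupp.linearCombination ℂ F

/-- The operator that is diagonal in the basis, with the given eigenvalues. -/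
def diagOp (F : Basis → ℝ) : Op := ofKets fun b => (F b : ℂ) • ket b

/-- The sum of a family of operators of which only finitely many are nonzero on each
basis state. All the families used below have this property, see the theorems that end
in `_locallyFinite`. -/
def opSum {ι : Type} (F : ι → Op) : Op := ofKets fun b => ∑ᶠ i, F i (ket b)

/-! ### Oscillators -/

/-- Removes a quantum of the mode `k`, with matrix elements `√(|k| n_k)`. -/
def lower (k : Mode) : Op := ofKets fun b =>
  ((Real.sqrt (|(k : ℤ)| * (b.1 k : ℝ)) : ℝ) : ℂ) • ket (b.1 - Finsupp.single k 1, b.2)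

/-- Adds a quantum of the mode `k`, with matrix elements `√(|k| (n_k + 1))`. -/
def raise (k : Mode) : Op := ofKets fun b =>
  ((Real.sqrt (|(k : ℤ)| * ((b.1 k : ℝ) + 1)) : ℝ) : ℂ) • ket (b.1 + Finsupp.single k 1, b.2)

open Classical in
/-- The oscillator variable `a_k`, with `[a_k, a_n⁺] = k δ_{kn}`: it annihilates a quantum of the
mode `k` if `k > 0` and creates one if `k < 0`. It is `0` if `k` is not an independent mode. -/
def a (k : ℤ) : Op :=
  if h : IsMode k then (if 0 < k then lower ⟨k, h⟩ else raise ⟨k, h⟩) else 0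

open Classical in
/-- The Hermitian conjugate `a_k⁺` of `a_k`. -/
def aDag (k : ℤ) : Op :=
  if h : IsMode k then (if 0 < k then raise ⟨k, h⟩ else lower ⟨k, h⟩) else 0

/-- The eigenvalue `∑ |k| n_k` of `L_0^{(2)} = ∑ :a_k⁺ a_k:`. -/
def level (b : Basis) : ℕ := b.1.sum fun k n => (k : ℤ).natAbs * n

/-- The eigenvalue `∑ sign(k) n_k` of `A_3^{(2)} = ∑ (1/k) :a_k⁺ a_k:`. -/
def helicity (b : Basis) : ℤ := b.1.sum fun k n => Int.sign (k : ℤ) * (n : ℤ)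

/-- The operator `L_0^{(2)}`. -/
def L0 : Op := diagOp fun b => level b

/-- The operator `A_3^{(2)}`. -/
def A3 : Op := diagOp fun b => helicity b

/-- `Σ_+ = ∑_{n,k} (1/n) a_n⁺ a_k⁺ a_{n+k}`. -/
def SigmaPlus : Op := opSum fun p : ℤ × ℤ =>
  (1 / (p.1 : ℂ)) • (aDag p.1 * aDag p.2 * a (p.1 + p.2))

/-- `Σ_- = ∑_{n,k} (1/n) a_n a_k a_{n+k}⁺`. -/
def SigmaMinus : Op := opSum fun p : ℤ × ℤ =>
  (1 / (p.1 : ℂ)) • (a p.1 * a p.2 * aDag (p.1 + p.2))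

/-- `f_+ = ∑_k (1/k + 1/2) a_k a_{k+2}⁺`. -/
def fPlus : Op := opSum fun k : ℤ => (1 / (k : ℂ) + 1 / 2) • (a k * aDag (k + 2))

/-- `f_- = ∑_k (1/k - 1/2) a_k a_{k-2}⁺`. -/
def fMinus : Op := opSum fun k : ℤ => (1 / (k : ℂ) - 1 / 2) • (a k * aDag (k - 2))

/-- The Hermitian conjugate of `f_+`. -/
def fPlusDag : Op := opSum fun k : ℤ => (1 / (k : ℂ) + 1 / 2) • (aDag k * a (k + 2))

/-- The Hermitian conjugate of `f_-`. -/
def fMinusDag : Op := opSum fun k : ℤ => (1 / (k : ℂ) - 1 / 2) • (aDag k * a (k - 2))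

/-- `g_+ = ∑_{n+k=-2} (1/n) a_n a_k`. -/
def gPlus : Op := opSum fun n : ℤ => (1 / (n : ℂ)) • (a n * a (-2 - n))

/-- `g'_- = ∑_{n+k=2} (1/n) a_n a_k` without the term `n = k = 1`. -/
def gMinus : Op := opSum fun n : ℤ => if n = 1 then 0 else (1 / (n : ℂ)) • (a n * a (2 - n))

/-- The Hermitian conjugate of `g_+`. -/
def gPlusDag : Op := opSum fun n : ℤ => (1 / (n : ℂ)) • (aDag n * aDag (-2 - n))

/-- The Hermitian conjugate of `g'_-`. -/
def gMinusDag : Op := opSum fun n : ℤ =>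
  if n = 1 then 0 else (1 / (n : ℂ)) • (aDag n * aDag (2 - n))

/-! ### Spin -/

open Classical in
/-- The basis state with `S_3` replaced by `m`, or `0` if there is none. -/
def ketLow (b : Basis) (m : ℤ) : Vec :=
  if h : |m| ≤ (b.2.S : ℤ) then ket (b.1, ⟨b.2.S, m, b.2.up, h, b.2.hup⟩) else 0

/-- `S_+` lowers `S_3` by one. -/
def spinPlus : Op := ofKets fun b =>
  ((Real.sqrt ((b.2.S : ℝ) * (b.2.S + 1) - b.2.low * (b.2.low - 1)) : ℝ) : ℂ) •
    ketLow b (b.2.low - 1)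

/-- `S_-` raises `S_3` by one. -/
def spinMinus : Op := ofKets fun b =>
  ((Real.sqrt ((b.2.S : ℝ) * (b.2.S + 1) - b.2.low * (b.2.low + 1)) : ℝ) : ℂ) •
    ketLow b (b.2.low + 1)

/-- The operator `S_3`. -/
def spin3 : Op := diagOp fun b => b.2.low

/-- The Casimir operator `S_i S_i`. -/
def spinSq : Op :=
  spin3 * spin3 + (1 / 2 : ℂ) • (spinPlus * spinMinus + spinMinus * spinPlus)

/-- `γ = (L_0^{(2)} + c_2)^{-1/2}`. -/
def gammaOp (c₂ : ℝ) : Op := diagOp fun b => (Real.sqrt ((level b : ℝ) + c₂))⁻¹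

/-- `γ⁻¹ = (L_0^{(2)} + c_2)^{1/2}`. -/
def gammaInvOp (c₂ : ℝ) : Op := diagOp fun b => Real.sqrt ((level b : ℝ) + c₂)

/-- The eigenvalue of `ñ_1 = a_1⁺ a_1 + c_1`. -/
def n1 (c₁ : ℝ) (b : Basis) : ℝ := (b.1 ⟨1, by decide, by decide, by decide⟩ : ℝ) + c₁

/-! ### Elementary symbols and their ordering -/

/-- Symbols for the elementary variables: a suffix `s` marks the conjugate of a symbol. -/
inductive Elem : Type where
  | a1 | a1s
  | dp | dps | dm | dms
  | fp | fps | fm | fms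
  | gp | gps | gm | gms
  | sigP | sigM | spP | spM | gam | gamInv
  deriving DecidableEq

namespace Elem

/-- Conjugation of symbols. -/
def conj : Elem → Elem
  | a1 => a1s | a1s => a1
  | dp => dps | dps => dp | dm => dms | dms => dm
  | fp => fps | fps => fp | fm => fms | fms => fm
  | gp => gps | gps => gp | gm => gms | gms => gm
  | sigP => sigM | sigM => sigP | spP => spM | spM => spP
  | gam => gam | gamInv => gamInv

/-- The change of `L_0^{(2)}` produced by the operator of the symbol. -/
def charge : Elem → ℤ
  | a1s => 1 | dp => 4 | dms => 4 | fp => 2 | fms => 2 | gp => 2 | gms => 2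
  | a1 => -1 | dm => -4 | dps => -4 | fm => -2 | fps => -2 | gm => -2 | gps => -2
  | sigP => 0 | sigM => 0 | spP => 0 | spM => 0 | gam => 0 | gamInv => 0

/-- The operator of an elementary symbol. -/
def op (c₂ : ℝ) : Elem → Op
  | a1 => a 1
  | a1s => aDag 1
  | dp => (1 / 2 : ℂ) • aDag 4
  | dps => (1 / 2 : ℂ) • a 4
  | dm => (1 / 2 : ℂ) • aDag (-4)
  | dms => (1 / 2 : ℂ) • a (-4)
  | fp => fPlus
  | fps => fPlusDag
  | fm => fMinus
  | fms => fMinusDag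
  | gp => gPlus
  | gps => gPlusDag
  | gm => gMinus
  | gms => gMinusDag
  | sigP => SigmaPlus
  | sigM => SigmaMinus
  | spP => spinPlus
  | spM => spinMinus
  | gam => gammaOp c₂
  | gamInv => gammaInvOp c₂

end Elem

/-- A normal ordering of the elementary symbols, listed from left to right: every symbol occurs
exactly once, the `L_0^{(2)}`-raising symbols stand on the left, the neutral ones in the middle,
the `L_0^{(2)}`-lowering ones on the right, and `S_+` stands to the left of `S_-`. -/
structure IsOrdering (s : List Elem) : Prop where
  nodup : s.Nodup
  mem : ∀ e, e ∈ s
  sorted : s.Pairwise fun x y => (y.charge).sign ≤ (x.charge).sign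
  spin : List.Sublist [Elem.spP, Elem.spM] s

/-- The ordered operator of a monomial. -/
def ordMonomial (c₂ : ℝ) (s : List Elem) (m : Elem →₀ ℕ) : Op :=
  (s.map fun e => e.op c₂ ^ m e).prod

/-- Commutative polynomials in the elementary symbols. -/
abbrev EPoly : Type := MvPolynomial Elem ℚ

/-- The ordered operator `:p:` of a polynomial. -/
def ordered (c₂ : ℝ) (s : List Elem) (p : EPoly) : Op :=
  ∑ m ∈ p.support, ((p.coeff m : ℚ) : ℂ) • ordMonomial c₂ s m

/-! ### The polynomials `P_n` -/

namespace EPoly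

open MvPolynomial Elem

/-- Complex conjugation of polynomials. -/
def conj (p : EPoly) : EPoly := rename Elem.conj p

/-- `d = d_+ - d_-`. -/
def d : EPoly := X dp - X dm

/-- `f = f_+ - f_-`. -/
def f : EPoly := X fp - X fm

/-- `g' = g'_- - g_+`. -/
def g : EPoly := X gm - X gp

/-- The pair `(P_n, b_n)`, for `n ≥ 1`: the coefficients of the solution
`a_2 = ∑ P_n a_1^2 / |a_1|^(4n)`, `β = ∑ b_n / |a_1|^(4n)` of
`a_2 = (a_1^2 / |a_1|^4) (-z + (S_+/γ)(1 + β))`, `β = a_2^* a_2 γ^2 - β^2/2`,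
`z = Σ_+ + f^* a_2^* + g'^* a_2 + d^* a_2^{*2} + d a_2 a_2^* / 2`. -/
def PB : ℕ → EPoly × EPoly
  | 0 => (0, 0)
  | 1 => (-X sigP + X spP * X gamInv, 0)
  | n + 2 =>
    ( - conj f * X a1s ^ 2 * conj (PB (n + 1)).1
      - conj g * X a1 ^ 2 * (PB (n + 1)).1
      - conj d * X a1s ^ 4 * ∑ j : Fin n, conj (PB (n - j)).1 * conj (PB (j + 1)).1
      - C (1 / 2) * d * X a1s ^ 2 * X a1 ^ 2 *
          ∑ j : Fin n, (PB (n - j)).1 * conj (PB (j + 1)).1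
      + X spP * X gamInv * (PB (n + 1)).2,
      X a1s ^ 2 * X a1 ^ 2 * X gam ^ 2 *
          ∑ j : Fin (n + 1), conj (PB (n + 1 - j)).1 * (PB (j + 1)).1
      - C (1 / 2) * ∑ j : Fin (n + 1), (PB (n + 1 - j)).2 * (PB (j + 1)).2 )
  decreasing_by all_goals (simp_wf; try omega)

/-- The polynomial `P_n`, `n ≥ 1`. -/
def P (n : ℕ) : EPoly := (PB n).1

end EPoly

/-! ### The operators `α_2`, `α_2⁺` and the mass-squared operator -/

/-- The matrix element `⟨b| ñ_1^{-(2n-1)} :P_n: |b'⟩`. -/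
def alpha2Term (c₁ c₂ : ℝ) (s : List Elem) (n : ℕ) (b b' : Basis) : ℂ :=
  (((n1 c₁ b)⁻¹ ^ (2 * n - 1) : ℝ) : ℂ) * (ordered c₂ s (EPoly.P n) (ket b')) b

/-- The matrix element `⟨b| α_2 |b'⟩`, where `α_2 = ∑_{n ≥ 1} ñ_1^{-2n+1} :P_n:`; only finitely
many terms are nonzero (see `alpha2_terms_finite`). -/
def alpha2 (c₁ c₂ : ℝ) (s : List Elem) (b b' : Basis) : ℂ :=
  ∑ᶠ n : ℕ, alpha2Term c₁ c₂ s (n + 1) b b'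

/-- The matrix element `⟨b| α_2⁺ |b'⟩` of the Hermitian conjugate. -/
def alpha2Dag (c₁ c₂ : ℝ) (s : List Elem) (b b' : Basis) : ℂ :=
  starRingEnd ℂ (alpha2 c₁ c₂ s b' b)

/-- The operator with matrix elements `A` is defined on the vector with components `v` and sends it
to the vector with components `w`. -/
def Maps (A : Basis → Basis → ℂ) (v w : Basis → ℂ) : Prop :=
  ∀ b, HasSum (fun b' => A b b' * v b') (w b)

/-- The mass-squared operator `P²/2π = L_0^{(2)} + 2 α_2 α_2⁺ + c_3` is defined on the vector `v`
and sends it to `w`. -/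
def MassSqMaps (c₁ c₂ c₃ : ℝ) (s : List Elem) (v w : Basis → ℂ) : Prop :=
  ∃ x y : Basis → ℂ, Maps (alpha2Dag c₁ c₂ s) v x ∧ Maps (alpha2 c₁ c₂ s) x y ∧
    w = fun b => (level b : ℂ) * v b + 2 * y b + (c₃ : ℂ) * v b

/-! ### The table of states -/

open Classical in
/-- Occupation numbers with `n` quanta in the mode `k` and no other quanta. -/
def occ (k : ℤ) (n : ℕ) : Occ := if h : IsMode k then Finsupp.single ⟨k, h⟩ n else 0

/-- The rows `(P²/2π = L_0^{(2)}, S = S_3 = A_3^{(2)}, {n_k})` of the table. -/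
def table : List (ℕ × ℕ × Occ) :=
  [ (0, 0, 0),
    (2, 0, occ 1 1 + occ (-1) 1),
    (4, 0, occ 1 2 + occ (-1) 2),
    (1, 1, occ 1 1),
    (3, 1, occ 3 1) ]

/-- The state with oscillator part `{n_k}`, spin `S`, maximal `S_3 = S`, and `S^3 = M`. -/
def topState (ν : Occ) (S : ℕ) (M : ℤ) (hM : |M| ≤ (S : ℤ)) : Basis :=
  (ν, ⟨S, S, M, by simp, hM⟩)

end

/-! ### The sums that define the operators are finite -/

theorem ofKets_ket (F : Basis → Vec) (b : Basis) : ofKets F (ket b) = F b := by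
  simp [ofKets, ket]

/-- Every component of `v` has its occupied modes in `T`. -/
def SuppIn (T : Set ℤ) (v : Vec) : Prop :=
  ∀ b, v b ≠ 0 → ∀ k : Mode, b.1 k ≠ 0 → (k : ℤ) ∈ T

theorem ofKets_apply_ne {F : Basis → Vec} {v : Vec} {b : Basis} (h : ofKets F v b ≠ 0) :
    ∃ b', v b' ≠ 0 ∧ F b' b ≠ 0 := by
  by_contra! hc
  apply h
  simp only [ofKets, Finsupp.linearCombination_apply, Finsupp.sum, Finsupp.finsetSum_apply,
    Finsupp.smul_apply, smul_eq_mul]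
  refine Finset.sum_eq_zero fun b' hb' => ?_
  rw [hc b' (Finsupp.mem_support_iff.mp hb'), mul_zero]

theorem ne_zero_apply {v : Vec} (h : v ≠ 0) : ∃ b, v b ≠ 0 := by
  by_contra! hc
  exact h (Finsupp.ext hc)

theorem lower_apply_ne {k : Mode} {v : Vec} {b : Basis} (h : lower k v b ≠ 0) :
    ∃ b', v b' ≠ 0 ∧ b'.1 k ≠ 0 ∧ b = (b'.1 - Finsupp.single k 1, b'.2) := by
  obtain ⟨b', h1, h2⟩ := ofKets_apply_ne h
  refine ⟨b', h1, ?_, ?_⟩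
  · rintro h0
    simp [h0] at h2
  · by_contra hne
    simp [ket, Ne.symm hne] at h2

theorem raise_apply_ne {k : Mode} {v : Vec} {b : Basis} (h : raise k v b ≠ 0) :
    ∃ b', v b' ≠ 0 ∧ b = (b'.1 + Finsupp.single k 1, b'.2) := by
  obtain ⟨b', h1, h2⟩ := ofKets_apply_ne h
  refine ⟨b', h1, ?_⟩
  by_contra hne
  simp [ket, Ne.symm hne] at h2

theorem lower_suppIn {T : Set ℤ} {k : Mode} {v : Vec} (hv : SuppIn T v) :
    SuppIn T (lower k v) ∧ (lower k v ≠ 0 → (k : ℤ) ∈ T) := by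
  constructor
  · intro b hb j hj
    obtain ⟨b', h1, h2, rfl⟩ := lower_apply_ne hb
    refine hv b' h1 j fun h0 => hj ?_
    simp [h0]
  · intro h
    obtain ⟨b, hb⟩ := ne_zero_apply h
    obtain ⟨b', h1, h2, -⟩ := lower_apply_ne hb
    exact hv b' h1 k h2

theorem raise_suppIn {T : Set ℤ} {k : Mode} {v : Vec} (hv : SuppIn T v) :
    SuppIn (insert (k : ℤ) T) (raise k v) := by
  intro b hb j hj
  obtain ⟨b', h1, rfl⟩ := raise_apply_ne hb
  by_cases hjk : j = k
  · left; rw [hjk]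
  · right
    refine hv b' h1 j fun h0 => hj ?_
    simp [h0, Ne.symm hjk]

theorem a_suppIn {T : Set ℤ} {k : ℤ} {v : Vec} (hv : SuppIn T v) :
    SuppIn {j | j ∈ T ∨ (k < 0 ∧ j = k)} (a k v) ∧ (a k v ≠ 0 → k ≠ 0 ∧ (k < 0 ∨ k ∈ T)) := by
  unfold a
  split_ifs with h h0
  · have := lower_suppIn (k := ⟨k, h⟩) hv
    exact ⟨fun b hb j hj => Or.inl (this.1 b hb j hj), fun hn => ⟨h.1, Or.inr (this.2 hn)⟩⟩
  · have := raise_suppIn (k := ⟨k, h⟩) hv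
    have hk : k < 0 := lt_of_le_of_ne (not_lt.mp h0) h.1
    exact ⟨fun b hb j hj => (this b hb j hj).symm.imp_right fun h => ⟨hk, h⟩,
      fun hn => ⟨h.1, Or.inl hk⟩⟩
  · exact ⟨fun b hb => absurd rfl hb, fun hn => absurd rfl hn⟩

theorem aDag_suppIn {T : Set ℤ} {k : ℤ} {v : Vec} (hv : SuppIn T v) :
    SuppIn {j | j ∈ T ∨ (0 < k ∧ j = k)} (aDag k v) ∧
      (aDag k v ≠ 0 → k ≠ 0 ∧ (0 < k ∨ k ∈ T)) := by
  unfold aDag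
  split_ifs with h h0
  · have := raise_suppIn (k := ⟨k, h⟩) hv
    exact ⟨fun b hb j hj => (this b hb j hj).symm.imp_right fun h => ⟨h0, h⟩,
      fun hn => ⟨h.1, Or.inl h0⟩⟩
  · have := lower_suppIn (k := ⟨k, h⟩) hv
    exact ⟨fun b hb j hj => Or.inl (this.1 b hb j hj), fun hn => ⟨h.1, Or.inr (this.2 hn)⟩⟩
  · exact ⟨fun b hb => absurd rfl hb, fun hn => absurd rfl hn⟩

theorem ket_suppIn (b : Basis) : ∃ B : ℤ, SuppIn {j | |j| ≤ B} (ket b) := by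
  refine ⟨∑ k ∈ b.1.support, |(k : ℤ)|, fun b' hb' k hk => ?_⟩
  have : b = b' := by
    by_contra hne
    simp [ket, hne] at hb'
  subst this
  exact Finset.single_le_sum (f := fun k : Mode => |(k : ℤ)|) (fun _ _ => abs_nonneg _)
    (Finsupp.mem_support_iff.mpr hk)

/-- Only finitely many operators of the family are nonzero on each basis state. -/
def LocallyFinite {ι : Type} (F : ι → Op) : Prop :=
  ∀ b, {i | F i (ket b) ≠ 0}.Finite

theorem locallyFinite_of_bound {F : ℤ → Op}
    (h : ∀ b, ∃ B : ℤ, ∀ k, F k (ket b) ≠ 0 → -B ≤ k ∧ k ≤ B) : LocallyFinite F := by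
  intro b
  obtain ⟨B, hB⟩ := h b
  exact (Set.finite_Icc (-B) B).subset fun k hk => hB k hk

theorem smul_mul_ne {c : ℂ} {A B : Op} {v : Vec} (h : (c • (A * B)) v ≠ 0) :
    A (B v) ≠ 0 ∧ B v ≠ 0 := by
  constructor <;> · intro h0; apply h; simp [h0]

theorem a_aDag_bound (b : Basis) : ∃ B : ℤ, ∀ k l : ℤ, a k (aDag l (ket b)) ≠ 0 →
    aDag l (ket b) ≠ 0 → k ≠ l → (0 < l ∨ |l| ≤ B) ∧ (k < 0 ∨ |k| ≤ B) := by
  obtain ⟨B, hB⟩ := ket_suppIn b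
  refine ⟨B, fun k l h1 h2 hne => ?_⟩
  have h3 := aDag_suppIn (k := l) hB
  have h4 := (a_suppIn (k := k) h3.1).2 h1
  have h5 := h3.2 h2
  simp only [Set.mem_ofPred_eq] at h4 h5
  tauto

theorem aDag_a_bound (b : Basis) : ∃ B : ℤ, ∀ k l : ℤ, aDag k (a l (ket b)) ≠ 0 →
    a l (ket b) ≠ 0 → k ≠ l → (l < 0 ∨ |l| ≤ B) ∧ (0 < k ∨ |k| ≤ B) := by
  obtain ⟨B, hB⟩ := ket_suppIn b
  refine ⟨B, fun k l h1 h2 hne => ?_⟩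
  have h3 := a_suppIn (k := l) hB
  have h4 := (aDag_suppIn (k := k) h3.1).2 h1
  have h5 := h3.2 h2
  simp only [Set.mem_ofPred_eq] at h4 h5
  tauto

theorem a_a_bound (b : Basis) : ∃ B : ℤ, ∀ k l : ℤ, a k (a l (ket b)) ≠ 0 →
    a l (ket b) ≠ 0 → (l < 0 ∨ |l| ≤ B) ∧ (k < 0 ∨ |k| ≤ B) := by
  obtain ⟨B, hB⟩ := ket_suppIn b
  refine ⟨B, fun k l h1 h2 => ?_⟩
  have h3 := a_suppIn (k := l) hB
  have h4 := (a_suppIn (k := k) h3.1).2 h1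
  have h5 := h3.2 h2
  simp only [Set.mem_ofPred_eq] at h4 h5
  refine ⟨h5.2, ?_⟩
  rcases h4.2 with h | h | h
  · exact Or.inl h
  · exact Or.inr h
  · left; omega

theorem aDag_aDag_bound (b : Basis) : ∃ B : ℤ, ∀ k l : ℤ, aDag k (aDag l (ket b)) ≠ 0 →
    aDag l (ket b) ≠ 0 → (0 < l ∨ |l| ≤ B) ∧ (0 < k ∨ |k| ≤ B) := by
  obtain ⟨B, hB⟩ := ket_suppIn b
  refine ⟨B, fun k l h1 h2 => ?_⟩
  have h3 := aDag_suppIn (k := l) hB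
  have h4 := (aDag_suppIn (k := k) h3.1).2 h1
  have h5 := h3.2 h2
  simp only [Set.mem_ofPred_eq] at h4 h5
  refine ⟨h5.2, ?_⟩
  rcases h4.2 with h | h | h
  · exact Or.inl h
  · exact Or.inr h
  · left; omega

theorem fPlus_locallyFinite :
    LocallyFinite fun k : ℤ => (1 / (k : ℂ) + 1 / 2) • (a k * aDag (k + 2)) := by
  refine locallyFinite_of_bound fun b => ?_
  obtain ⟨B, hB⟩ := a_aDag_bound b
  refine ⟨|B| + 2, fun k hk => ?_⟩
  obtain ⟨h1, h2⟩ := smul_mul_ne hk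
  have := hB _ _ h1 h2 (by omega)
  simp only [abs_le] at this
  have := le_abs_self B
  have := abs_nonneg B
  omega

theorem fMinus_locallyFinite :
    LocallyFinite fun k : ℤ => (1 / (k : ℂ) - 1 / 2) • (a k * aDag (k - 2)) := by
  refine locallyFinite_of_bound fun b => ?_
  obtain ⟨B, hB⟩ := a_aDag_bound b
  refine ⟨|B| + 2, fun k hk => ?_⟩
  obtain ⟨h1, h2⟩ := smul_mul_ne hk
  have := hB _ _ h1 h2 (by omega)
  simp only [abs_le] at this
  have := le_abs_self B
  have := abs_nonneg B
  omega

theorem fPlusDag_locallyFinite :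
    LocallyFinite fun k : ℤ => (1 / (k : ℂ) + 1 / 2) • (aDag k * a (k + 2)) := by
  refine locallyFinite_of_bound fun b => ?_
  obtain ⟨B, hB⟩ := aDag_a_bound b
  refine ⟨|B| + 2, fun k hk => ?_⟩
  obtain ⟨h1, h2⟩ := smul_mul_ne hk
  have := hB _ _ h1 h2 (by omega)
  simp only [abs_le] at this
  have := le_abs_self B
  have := abs_nonneg B
  omega

theorem fMinusDag_locallyFinite :
    LocallyFinite fun k : ℤ => (1 / (k : ℂ) - 1 / 2) • (aDag k * a (k - 2)) := by
  refine locallyFinite_of_bound fun b => ?_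
  obtain ⟨B, hB⟩ := aDag_a_bound b
  refine ⟨|B| + 2, fun k hk => ?_⟩
  obtain ⟨h1, h2⟩ := smul_mul_ne hk
  have := hB _ _ h1 h2 (by omega)
  simp only [abs_le] at this
  have := le_abs_self B
  have := abs_nonneg B
  omega

theorem gPlus_locallyFinite :
    LocallyFinite fun n : ℤ => (1 / (n : ℂ)) • (a n * a (-2 - n)) := by
  refine locallyFinite_of_bound fun b => ?_
  obtain ⟨B, hB⟩ := a_a_bound b
  refine ⟨|B| + 2, fun k hk => ?_⟩
  obtain ⟨h1, h2⟩ := smul_mul_ne hk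
  have := hB _ _ h1 h2
  simp only [abs_le] at this
  have := le_abs_self B
  have := abs_nonneg B
  omega

theorem gPlusDag_locallyFinite :
    LocallyFinite fun n : ℤ => (1 / (n : ℂ)) • (aDag n * aDag (-2 - n)) := by
  refine locallyFinite_of_bound fun b => ?_
  obtain ⟨B, hB⟩ := aDag_aDag_bound b
  refine ⟨|B| + 2, fun k hk => ?_⟩
  obtain ⟨h1, h2⟩ := smul_mul_ne hk
  have := hB _ _ h1 h2
  simp only [abs_le] at this
  have := le_abs_self B
  have := abs_nonneg B
  omega

theorem gMinus_locallyFinite :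
    LocallyFinite fun n : ℤ =>
      if n = 1 then 0 else (1 / (n : ℂ)) • (a n * a (2 - n)) := by
  refine locallyFinite_of_bound fun b => ?_
  obtain ⟨B, hB⟩ := a_a_bound b
  refine ⟨|B| + 2, fun k hk => ?_⟩
  split_ifs at hk with h
  · simp at hk
  obtain ⟨h1, h2⟩ := smul_mul_ne hk
  have := hB _ _ h1 h2
  simp only [abs_le] at this
  have := le_abs_self B
  have := abs_nonneg B
  omega

theorem gMinusDag_locallyFinite :
    LocallyFinite fun n : ℤ =>
      if n = 1 then 0 else (1 / (n : ℂ)) • (aDag n * aDag (2 - n)) := by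
  refine locallyFinite_of_bound fun b => ?_
  obtain ⟨B, hB⟩ := aDag_aDag_bound b
  refine ⟨|B| + 2, fun k hk => ?_⟩
  split_ifs at hk with h
  · simp at hk
  obtain ⟨h1, h2⟩ := smul_mul_ne hk
  have := hB _ _ h1 h2
  simp only [abs_le] at this
  have := le_abs_self B
  have := abs_nonneg B
  omega

theorem sigmaPlus_locallyFinite :
    LocallyFinite fun p : ℤ × ℤ =>
      (1 / (p.1 : ℂ)) • (aDag p.1 * aDag p.2 * a (p.1 + p.2)) := by
  intro b
  obtain ⟨B, hB⟩ := ket_suppIn b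
  refine ((Set.finite_Icc (-(2 * |B|)) (2 * |B|)).prod
    (Set.finite_Icc (-(2 * |B|)) (2 * |B|))).subset ?_
  rintro ⟨n, k⟩ hnk
  obtain ⟨h1, h2⟩ := smul_mul_ne hnk
  rw [Module.End.mul_apply] at h1
  have h3 := a_suppIn (k := n + k) hB
  have h4 := aDag_suppIn (k := k) h3.1
  have h5 := (aDag_suppIn (k := n) h4.1).2 h1
  have h6 := h4.2 (fun h0 => h1 (by dsimp only at h0 ⊢; rw [h0, map_zero]))
  have h7 := h3.2 h2
  simp only [Set.mem_ofPred_eq, abs_le] at h5 h6 h7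
  have := le_abs_self B
  have := abs_nonneg B
  simp only [Set.mem_prod, Set.mem_Icc]
  omega

theorem sigmaMinus_locallyFinite :
    LocallyFinite fun p : ℤ × ℤ =>
      (1 / (p.1 : ℂ)) • (a p.1 * a p.2 * aDag (p.1 + p.2)) := by
  intro b
  obtain ⟨B, hB⟩ := ket_suppIn b
  refine ((Set.finite_Icc (-(2 * |B|)) (2 * |B|)).prod
    (Set.finite_Icc (-(2 * |B|)) (2 * |B|))).subset ?_
  rintro ⟨n, k⟩ hnk
  obtain ⟨h1, h2⟩ := smul_mul_ne hnk
  rw [Module.End.mul_apply] at h1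
  have h3 := aDag_suppIn (k := n + k) hB
  have h4 := a_suppIn (k := k) h3.1
  have h5 := (a_suppIn (k := n) h4.1).2 h1
  have h6 := h4.2 (fun h0 => h1 (by dsimp only at h0 ⊢; rw [h0, map_zero]))
  have h7 := h3.2 h2
  simp only [Set.mem_ofPred_eq, abs_le] at h5 h6 h7
  have := le_abs_self B
  have := abs_nonneg B
  simp only [Set.mem_prod, Set.mem_Icc]
  omega

/-! ### The series that define the matrix elements of `α_2` are finite sums -/

/-- All components of `v` have level `N`. -/
def HomVec (N : ℤ) (v : Vec) : Prop := ∀ b, v b ≠ 0 → (level b : ℤ) = N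

/-- The operator `A` changes the level by `δ`. -/
def HomOp (δ : ℤ) (A : Op) : Prop := ∀ N v, HomVec N v → HomVec (N + δ) (A v)

theorem level_add_single (ν : Occ) (t : Spin) (k : Mode) :
    level (ν + Finsupp.single k 1, t) = level (ν, t) + (k : ℤ).natAbs := by
  unfold level
  rw [Finsupp.sum_add_index' (by simp) (by intros; ring), Finsupp.sum_single_index (by simp)]
  simp

theorem level_sub_single (ν : Occ) (t : Spin) (k : Mode) (h : ν k ≠ 0) :
    level (ν, t) = level (ν - Finsupp.single k 1, t) + (k : ℤ).natAbs := by
  rw [← level_add_single]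
  congr 2
  ext j
  by_cases hj : j = k
  · subst hj; simp; omega
  · simp [Ne.symm hj]

theorem HomOp.lower (k : Mode) : HomOp (-|(k : ℤ)|) (lower k) := by
  intro N v hv b hb
  obtain ⟨b', h1, h2, rfl⟩ := lower_apply_ne hb
  have h3 := hv b' h1
  have h4 := level_sub_single b'.1 b'.2 k h2
  change level b' = _ at h4
  rw [Int.abs_eq_natAbs]
  omega

theorem HomOp.raise (k : Mode) : HomOp |(k : ℤ)| (raise k) := by
  intro N v hv b hb
  obtain ⟨b', h1, rfl⟩ := raise_apply_ne hb
  have h3 := hv b' h1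
  have h4 := level_add_single b'.1 b'.2 k
  change _ = level b' + _ at h4
  rw [Int.abs_eq_natAbs]
  omega

theorem HomOp.zero (δ : ℤ) : HomOp δ 0 := fun _ _ _ _ hb => absurd rfl hb

theorem HomOp.a (k : ℤ) : HomOp (-k) (a k) := by
  unfold LCString.a
  split_ifs with h h0
  · have := HomOp.lower ⟨k, h⟩
    rwa [abs_of_pos h0] at this
  · have := HomOp.raise ⟨k, h⟩
    rwa [abs_of_nonpos (not_lt.mp h0)] at this
  · exact HomOp.zero _

theorem HomOp.aDag (k : ℤ) : HomOp k (aDag k) := by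
  unfold LCString.aDag
  split_ifs with h h0
  · have := HomOp.raise ⟨k, h⟩
    rwa [abs_of_pos h0] at this
  · have := HomOp.lower ⟨k, h⟩
    rwa [abs_of_nonpos (not_lt.mp h0), neg_neg] at this
  · exact HomOp.zero _

theorem HomOp.mul {δ ε η : ℤ} {A B : Op} (hA : HomOp δ A) (hB : HomOp ε B) (h : η = δ + ε) :
    HomOp η (A * B) := by
  intro N v hv
  have := hA _ _ (hB _ _ hv)
  rwa [show N + ε + δ = N + η by omega] at this

theorem HomOp.smul {δ : ℤ} {A : Op} (c : ℂ) (hA : HomOp δ A) : HomOp δ (c • A) := by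
  intro N v hv b hb
  refine hA N v hv b fun h0 => hb ?_
  simp [h0]

theorem HomOp.pow {δ : ℤ} {A : Op} (hA : HomOp δ A) (m : ℕ) : HomOp (δ * m) (A ^ m) := by
  induction m with
  | zero => intro N v hv; simpa using hv
  | succ m ih =>
    rw [pow_succ]
    exact ih.mul hA (by push_cast; ring)

theorem ket_homVec (b : Basis) : HomVec (level b) (ket b) := by
  intro b' hb'
  have : b = b' := by
    by_contra hne
    simp [ket, hne] at hb'
  rw [this]

theorem ket_apply_ne {b b' : Basis} (h : ket b b' ≠ 0) : b' = b := by
  by_contra hne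
  simp [ket, Ne.symm hne] at h

theorem HomOp.ofKets {δ : ℤ} {F : Basis → Vec} (h : ∀ b, HomVec (level b + δ) (F b)) :
    HomOp δ (ofKets F) := by
  intro N v hv b hb
  obtain ⟨b', h1, h2⟩ := ofKets_apply_ne hb
  rw [h b' b h2, hv b' h1]

theorem HomOp.diagOp (F : Basis → ℝ) : HomOp 0 (diagOp F) := by
  refine HomOp.ofKets fun b b' hb' => ?_
  rw [ket_apply_ne (b := b) (b' := b') (fun h0 => hb' (by simp [h0])), add_zero]

theorem HomOp.opSum {ι : Type} {δ : ℤ} {F : ι → Op} (h : ∀ i, HomOp δ (F i)) :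
    HomOp δ (opSum F) := by
  refine HomOp.ofKets fun b => ?_
  refine finsum_induction (HomVec (level b + δ)) (fun b' hb' => absurd rfl hb') ?_
    fun i => h i _ _ (ket_homVec b)
  intro x y hx hy b' hb'
  by_cases h0 : x b' = 0
  · refine hy b' fun h1 => hb' ?_
    simp [h0, h1]
  · exact hx b' h0

theorem ketLow_homVec (b : Basis) (m : ℤ) (c : ℂ) : HomVec (level b + 0) (c • ketLow b m) := by
  intro b' hb'
  unfold ketLow at hb'
  split_ifs at hb' with h
  · have h1 : ket (b.1, ⟨b.2.S, m, b.2.up, h, b.2.hup⟩) b' ≠ 0 := fun h0 => hb' (by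
      rw [Finsupp.smul_apply, h0, smul_zero])
    rw [ket_apply_ne h1]
    simp [level]
  · simp at hb'

theorem Elem.op_homOp (c₂ : ℝ) (e : Elem) : HomOp e.charge (e.op c₂) := by
  cases e
  case a1 => exact HomOp.a 1
  case a1s => exact HomOp.aDag 1
  case dp => exact (HomOp.aDag 4).smul _
  case dps => exact (HomOp.a 4).smul _
  case dm => exact (HomOp.aDag (-4)).smul _
  case dms => exact (HomOp.a (-4)).smul _
  case fp => exact HomOp.opSum fun k => ((HomOp.a _).mul (HomOp.aDag _) (by simp [charge])).smul _
  case fps => exact HomOp.opSum fun k => ((HomOp.aDag _).mul (HomOp.a _) (by simp [charge])).smul _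
  case fm =>
    exact HomOp.opSum fun k => ((HomOp.a _).mul (HomOp.aDag _) (by simp only [charge]; ring)).smul _
  case fms =>
    exact HomOp.opSum fun k => ((HomOp.aDag _).mul (HomOp.a _) (by simp only [charge]; ring)).smul _
  case gp =>
    exact HomOp.opSum fun k => ((HomOp.a _).mul (HomOp.a _) (by simp only [charge]; ring)).smul _
  case gps =>
    exact HomOp.opSum fun k =>
      ((HomOp.aDag _).mul (HomOp.aDag _) (by simp only [charge]; ring)).smul _
  case gm =>
    refine HomOp.opSum fun k => ?_
    split_ifs
    · exact HomOp.zero _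
    · exact ((HomOp.a _).mul (HomOp.a _) (by simp only [charge]; ring)).smul _
  case gms =>
    refine HomOp.opSum fun k => ?_
    split_ifs
    · exact HomOp.zero _
    · exact ((HomOp.aDag _).mul (HomOp.aDag _) (by simp only [charge]; ring)).smul _
  case sigP =>
    exact HomOp.opSum fun p => (((HomOp.aDag _).mul (HomOp.aDag _) rfl).mul (HomOp.a _)
      (by simp only [charge]; ring)).smul _
  case sigM =>
    exact HomOp.opSum fun p => (((HomOp.a _).mul (HomOp.a _) rfl).mul (HomOp.aDag _)
      (by simp only [charge]; ring)).smul _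
  case spP => exact HomOp.ofKets fun b => ketLow_homVec b _ _
  case spM => exact HomOp.ofKets fun b => ketLow_homVec b _ _
  case gam => exact HomOp.diagOp _
  case gamInv => exact HomOp.diagOp _

/-- The total amounts by which the factors of a monomial raise and lower the level. -/
theorem ordMonomial_bound (c₂ : ℝ) (m : Elem →₀ ℕ) (s : List Elem)
    (hs : s.Pairwise fun x y => (y.charge).sign ≤ (x.charge).sign) (N : ℕ) (v : Vec)
    (hv : HomVec N v) :
    HomVec (N + (s.map fun e => e.charge * m e).sum) (ordMonomial c₂ s m v) ∧
    ∀ b, ordMonomial c₂ s m v b ≠ 0 →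
      (s.map fun e => max e.charge 0 * m e).sum ≤ level b ∧
      (s.map fun e => max (-e.charge) 0 * m e).sum ≤ N := by
  induction s with
  | nil => exact ⟨by simpa [ordMonomial] using hv, fun b _ => by simp⟩
  | cons e l ih =>
    obtain ⟨he, hl⟩ := List.pairwise_cons.mp hs
    obtain ⟨ih1, ih2⟩ := ih hl
    have hop : ordMonomial c₂ (e :: l) m v = (e.op c₂ ^ m e) (ordMonomial c₂ l m v) := by
      simp [ordMonomial]
    have hh := (Elem.op_homOp c₂ e).pow (m e)
    have hhom : HomVec (N + ((e :: l).map fun e => e.charge * (m e : ℤ)).sum)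
        (ordMonomial c₂ (e :: l) m v) := by
      rw [hop]
      have := hh _ _ ih1
      simp only [List.map_cons, List.sum_cons]
      rwa [add_assoc, add_comm (List.sum _) _] at this
    refine ⟨hhom, fun b hb => ?_⟩
    have hne : ordMonomial c₂ l m v ≠ 0 := by
      intro h0
      rw [hop, h0, map_zero] at hb
      exact hb rfl
    obtain ⟨b', hb'⟩ := ne_zero_apply hne
    have hlev := hhom b hb
    have hlev' := ih1 b' hb'
    have hbd := ih2 b' hb'
    simp only [List.map_cons, List.sum_cons] at hlev ⊢
    have hm : (0 : ℤ) ≤ m e := Int.natCast_nonneg _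
    rcases lt_or_ge e.charge 0 with hneg | hpos
    · have h0 : ∀ x ∈ l, x.charge < 0 := by
        intro x hx
        have := he x hx
        rw [Int.sign_eq_neg_one_of_neg hneg] at this
        by_contra hc
        have := Int.sign_nonneg_iff.mpr (not_lt.mp hc)
        omega
      have h1 : (l.map fun e => max e.charge 0 * (m e : ℤ)) = l.map fun _ => 0 :=
        List.map_congr_left fun x hx => by rw [max_eq_right (h0 x hx).le, zero_mul]
      have h2 : (l.map fun e => max (-e.charge) 0 * (m e : ℤ)) =
          l.map fun e => -(e.charge * (m e : ℤ)) :=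
        List.map_congr_left fun x hx => by
          rw [max_eq_left (by have := h0 x hx; omega), neg_mul]
      have h3 : (l.map fun e => -(e.charge * (m e : ℤ))).sum =
          -(l.map fun e => e.charge * (m e : ℤ)).sum := by
        clear * -
        induction l with
        | nil => simp
        | cons x l ih => simp only [List.map_cons, List.sum_cons, ih]; ring
      have h4 : (l.map fun _ => (0 : ℤ)).sum = 0 := by simp
      rw [h1, h2, h3, h4, max_eq_right hneg.le, max_eq_left (by omega), neg_mul]
      constructor <;> omega
    · rw [max_eq_left hpos, max_eq_right (by omega), zero_mul, zero_add]
      exact ⟨by omega, hbd.2⟩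

/-- Counts the symbols `a_1`, `a_1^*`. -/
def a1Weight : Elem → ℕ
  | .a1 => 1 | .a1s => 1 | _ => 0

namespace EPoly
open MvPolynomial Elem

theorem conj_hom {p : EPoly} {n : ℕ} (h : IsWeightedHomogeneous a1Weight p n) :
    IsWeightedHomogeneous a1Weight (conj p) n := by
  intro m hm
  obtain ⟨u, hu, hc⟩ := coeff_rename_ne_zero _ _ _ hm
  have := h hc
  rw [← this, ← hu]
  simp only [Finsupp.weight_apply]
  rw [Finsupp.sum_mapDomain_index (by simp) (by intros; simp [add_mul])]
  refine Finsupp.sum_congr fun x _ => ?_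
  cases x <;> rfl

theorem X_hom (e : Elem) : IsWeightedHomogeneous a1Weight (X e : EPoly) (a1Weight e) :=
  isWeightedHomogeneous_X _ _ _

theorem PB_hom (n : ℕ) :
    IsWeightedHomogeneous a1Weight (PB n).1 (2 * (n - 1)) ∧
    IsWeightedHomogeneous a1Weight (PB n).2 (2 * n) := by
  induction n using Nat.strong_induction_on with
  | _ n ih =>
  match n with
  | 0 =>
    rw [PB]
    exact ⟨isWeightedHomogeneous_zero _ _ _, isWeightedHomogeneous_zero _ _ _⟩
  | 1 =>
    rw [PB]
    refine ⟨?_, isWeightedHomogeneous_zero _ _ _⟩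
    have h1 := (X_hom spP).mul (X_hom gamInv)
    exact (weightedHomogeneousSubmodule ℚ a1Weight 0).add_mem
      ((weightedHomogeneousSubmodule ℚ a1Weight 0).neg_mem (X_hom sigP)) h1
  | n + 2 =>
    have hd : IsWeightedHomogeneous a1Weight d 0 :=
      (weightedHomogeneousSubmodule ℚ a1Weight 0).sub_mem (X_hom dp) (X_hom dm)
    have hf : IsWeightedHomogeneous a1Weight f 0 :=
      (weightedHomogeneousSubmodule ℚ a1Weight 0).sub_mem (X_hom fp) (X_hom fm)
    have hg : IsWeightedHomogeneous a1Weight g 0 :=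
      (weightedHomogeneousSubmodule ℚ a1Weight 0).sub_mem (X_hom gm) (X_hom gp)
    have hC : IsWeightedHomogeneous a1Weight (C (1 / 2) : EPoly) 0 :=
      isWeightedHomogeneous_C _ _
    have cast {p : EPoly} {i j : ℕ} (h : IsWeightedHomogeneous a1Weight p i) (hij : i = j) :
      IsWeightedHomogeneous a1Weight p j := hij ▸ h
    have ha1 (k : ℕ) : IsWeightedHomogeneous a1Weight (X a1 ^ k : EPoly) k :=
      cast ((X_hom a1).pow k) (by simp [a1Weight])
    have ha1s (k : ℕ) : IsWeightedHomogeneous a1Weight (X a1s ^ k : EPoly) k :=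
      cast ((X_hom a1s).pow k) (by simp [a1Weight])
    have hgam : IsWeightedHomogeneous a1Weight (X gam ^ 2 : EPoly) 0 :=
      cast ((X_hom gam).pow 2) (by simp [a1Weight])
    have hsp : IsWeightedHomogeneous a1Weight (X spP * X gamInv : EPoly) 0 :=
      (X_hom spP).mul (X_hom gamInv)
    have hP := (ih (n + 1) (by omega)).1
    have hb := (ih (n + 1) (by omega)).2
    rw [PB]
    have sub {p q : EPoly} {i : ℕ} (hp : IsWeightedHomogeneous a1Weight p i)
        (hq : IsWeightedHomogeneous a1Weight q i) : IsWeightedHomogeneous a1Weight (p - q) i :=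
      (weightedHomogeneousSubmodule ℚ a1Weight i).sub_mem hp hq
    have neg {p : EPoly} {i : ℕ} (hp : IsWeightedHomogeneous a1Weight p i) :
        IsWeightedHomogeneous a1Weight (-p) i :=
      (weightedHomogeneousSubmodule ℚ a1Weight i).neg_mem hp
    constructor
    · refine IsWeightedHomogeneous.add (sub (sub (sub ?_ ?_) ?_) ?_) ?_
      · rw [neg_mul, neg_mul]
        exact neg (cast (((conj_hom hf).mul (ha1s 2)).mul (conj_hom hP)) (by omega))
      · exact cast (((conj_hom hg).mul (ha1 2)).mul hP) (by omega)
      · rcases Nat.eq_zero_or_pos n with rfl | hn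
        · simpa using isWeightedHomogeneous_zero ℚ a1Weight _
        · refine cast (((conj_hom hd).mul (ha1s 4)).mul
            (IsWeightedHomogeneous.sum _ _ (2 * (n - 1)) fun j _ => ?_)) (by omega)
          have h1 := (ih (n - j) (by omega)).1
          have h2 := (ih (j + 1) (by omega)).1
          exact cast ((conj_hom h1).mul (conj_hom h2)) (by omega)
      · rcases Nat.eq_zero_or_pos n with rfl | hn
        · simpa using isWeightedHomogeneous_zero ℚ a1Weight _
        · refine cast ((((hC.mul hd).mul (ha1s 2)).mul (ha1 2)).mul
            (IsWeightedHomogeneous.sum _ _ (2 * (n - 1)) fun j _ => ?_)) (by omega)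
          have h1 := (ih (n - j) (by omega)).1
          have h2 := (ih (j + 1) (by omega)).1
          exact cast (h1.mul (conj_hom h2)) (by omega)
      · exact cast (hsp.mul hb) (by omega)
    · refine sub ?_ ?_
      · refine cast ((((ha1s 2).mul (ha1 2)).mul hgam).mul
            (IsWeightedHomogeneous.sum _ _ (2 * n) fun j _ => ?_)) (by omega)
        have h1 := (ih (n + 1 - j) (by omega)).1
        have h2 := (ih (j + 1) (by omega)).1
        exact cast ((conj_hom h1).mul h2) (by omega)
      · refine cast (hC.mul
            (IsWeightedHomogeneous.sum _ _ (2 * (n + 2)) fun j _ => ?_)) (by omega)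
        have h1 := (ih (n + 1 - j) (by omega)).2
        have h2 := (ih (j + 1) (by omega)).2
        exact cast (h1.mul h2) (by omega)

end EPoly

/-- A matrix element of `:P_n:` vanishes unless `2 (n - 1)` is at most the sum of the levels. -/
theorem ordered_P_eq_zero (c₂ : ℝ) {s : List Elem} (hs : IsOrdering s) (n : ℕ) (b b' : Basis)
    (h : level b + level b' < 2 * (n - 1)) : ordered c₂ s (EPoly.P n) (ket b') b = 0 := by
  unfold ordered
  rw [LinearMap.sum_apply, Finsupp.finsetSum_apply]
  refine Finset.sum_eq_zero fun m hm => ?_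
  by_contra hne
  have hne' : ordMonomial c₂ s m (ket b') b ≠ 0 := fun h0 => hne (by simp [h0])
  obtain ⟨h1, h2⟩ := (ordMonomial_bound c₂ m s hs.sorted _ _ (ket_homVec b')).2 b hne'
  have hw := (EPoly.PB_hom n).1 (MvPolynomial.mem_support_iff.mp hm)
  have hcount : (m Elem.a1 : ℤ) + m Elem.a1s = 2 * (n - 1 : ℕ) := by
    have : Finsupp.weight a1Weight m = m Elem.a1 + m Elem.a1s := by
      rw [Finsupp.weight_apply, Finsupp.sum_of_support_subset m
        (s := s.toFinset) (fun e _ => List.mem_toFinset.mpr (hs.mem e)) _ (by simp)]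
      have hsub : ({Elem.a1, Elem.a1s} : Finset Elem) ⊆ s.toFinset :=
        fun e _ => List.mem_toFinset.mpr (hs.mem e)
      rw [← Finset.sum_subset hsub]
      · simp [a1Weight]
      · intro e _ he
        cases e <;> simp_all [a1Weight]
    omega
  have g1 : (m Elem.a1s : ℤ) ≤ (s.map fun e => max e.charge 0 * (m e : ℤ)).sum := by
    have := List.single_le_sum (l := s.map fun e => max e.charge 0 * (m e : ℤ))
      (by
        intro x hx
        obtain ⟨e, -, rfl⟩ := List.mem_map.mp hx
        positivity) _ (List.mem_map_of_mem (hs.mem Elem.a1s))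
    simpa [Elem.charge] using this
  have g2 : (m Elem.a1 : ℤ) ≤ (s.map fun e => max (-e.charge) 0 * (m e : ℤ)).sum := by
    have := List.single_le_sum (l := s.map fun e => max (-e.charge) 0 * (m e : ℤ))
      (by
        intro x hx
        obtain ⟨e, -, rfl⟩ := List.mem_map.mp hx
        positivity) _ (List.mem_map_of_mem (hs.mem Elem.a1))
    simpa [Elem.charge] using this
  omega

/-- The series that defines a matrix element of `α_2` is a finite sum. -/
theorem alpha2_terms_finite (c₁ c₂ : ℝ) {s : List Elem} (hs : IsOrdering s) (b b' : Basis) :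
    {n : ℕ | alpha2Term c₁ c₂ s (n + 1) b b' ≠ 0}.Finite := by
  refine (Set.finite_Iic (level b + level b')).subset fun n hn => ?_
  by_contra hc
  refine hn ?_
  unfold alpha2Term
  rw [ordered_P_eq_zero c₂ hs _ _ _ (by simp only [Set.mem_Iic] at hc; omega), mul_zero]

end LCString

namespace LCString

/-! ### Gradings of the polynomials `P_n` -/

namespace Elem

/-! The components of α_2⁺|b⟩ are the conjugates of row b of α_2, so it suffices that ⟨b| :P_n: = 0
for every n; the mass-squared operator then reduces to L_0^{(2)}. A row of an ordered monomial is
computed by letting its factors act on the bra ⟨b| from left to right. Each monomial contains a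
factor that kills the bra, and the factors to its left cannot spoil this
(`ordMonomial_apply_eq_zero`).

Which factors occur is decided by gradings that the recursion respects
(`EPoly.isWeightedHomogeneous_PB`). One of them gives P_n weight 1 while only Σ_± and S_± are
positive, so one of these occurs (`exists_sigma_or_spin`). Three gradings together show that if Σ_±
and S_+ are absent, then a_1^* occurs at least twice (`exists_sigma_or_spP_or_two_le_a1s`).

The factors kill for these reasons. Σ_± keeps the level, shifts the helicity by ±1 and changes the
number of quanta by at most 2. Since the modes ±2 are missing, only odd modes are occupied up to
level 3, so helicity and level have equal parity and Σ_± has no matrix elements. At level 4 only a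
single quantum in a mode ±4 breaks this parity, and it is too far from the four quanta of |2_1
2_{-1}⟩. S_± vanishes at S = 0, and S_+ kills the bra with S_3 = S. Two factors a_1^* exceed level
1; at level 3 they leave no room for another raising factor, so a_1^* meets the bra first and kills
it if the mode 1 is empty. The rows of the table with S = 0 need Σ_± and S_± only; those with S = 1
use the second alternative. -/

instance : Fintype Elem where
  elems := {a1, a1s, dp, dps, dm, dms, fp, fps, fm, fms, gp, gps, gm, gms, sigP, sigM, spP, spM,
    gam, gamInv}
  complete e := by cases e <;> decide

theorem conj_conj (e : Elem) : e.conj.conj = e := by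
  cases e <;> rfl

end Elem

/-- The weight `w` is compatible with the first half of the recursion for `P_n`, `b_n`, when all
`P_n` have weight `p`, their conjugates have weight `q`, and the `b_n` have weight `0`. -/
structure HalfCompatible {M : Type*} [AddCommGroup M] (w : Elem → M) (p q : M) : Prop where
  sigP : w .sigP = p
  spP : w .spP + w .gamInv = p
  fps : w .fps + 2 • w .a1s + q = p
  fms : w .fms + 2 • w .a1s + q = p
  gps : w .gps + 2 • w .a1 + p = p
  gms : w .gms + 2 • w .a1 + p = p
  dps : w .dps + 4 • w .a1s + (q + q) = p
  dms : w .dms + 4 • w .a1s + (q + q) = p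
  dp : w .dp + 2 • w .a1s + 2 • w .a1 + (p + q) = p
  dm : w .dm + 2 • w .a1s + 2 • w .a1 + (p + q) = p
  gam : 2 • w .a1s + 2 • w .a1 + 2 • w .gam + (q + p) = 0

/-- The recursion for `P_n`, `b_n` and its conjugate are homogeneous with respect to `w`, when all
`P_n` have weight `p`, their conjugates have weight `q`, and the `b_n` have weight `0`. -/
def Compatible {M : Type*} [AddCommGroup M] (w : Elem → M) (p q : M) : Prop :=
  HalfCompatible w p q ∧ HalfCompatible (fun e => w e.conj) q p

theorem Compatible.conj {M : Type*} [AddCommGroup M] {w : Elem → M} {p q : M}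
    (h : Compatible w p q) : Compatible (fun e => w e.conj) q p :=
  ⟨h.2, by simpa only [Elem.conj_conj] using h.1⟩

namespace EPoly
open MvPolynomial Elem

theorem isWeightedHomogeneous_conj {M : Type*} [AddCommGroup M] {w : Elem → M} {n : M} {p : EPoly}
    (h : IsWeightedHomogeneous (fun e => w e.conj) p n) : IsWeightedHomogeneous w (conj p) n := by
  intro m hm
  obtain ⟨u, hu, hc⟩ := coeff_rename_ne_zero _ _ _ hm
  rw [← h hc, ← hu]
  simp only [Finsupp.weight_apply]
  rw [Finsupp.sum_mapDomain_index (by simp) (by intros; simp [add_smul])]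

theorem conj_d : conj d = X dps - X dms := by simp [conj, d, Elem.conj]

theorem conj_f : conj f = X fps - X fms := by simp [conj, f, Elem.conj]

theorem conj_g : conj g = X gms - X gps := by simp [conj, g, Elem.conj]

/-- The recursion mixes P_k with its conjugate, so the induction runs over all weights at once: for
the conjugates, the hypothesis is used at the conjugate weight with p and q exchanged. Each summand
then matches one field of `HalfCompatible`. -/
theorem isWeightedHomogeneous_PB {M : Type*} [AddCommGroup M] (n : ℕ) (w : Elem → M) (p q : M)
    (h : Compatible w p q) :
    IsWeightedHomogeneous w (PB n).1 p ∧ IsWeightedHomogeneous w (PB n).2 0 := by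
  induction n using Nat.strong_induction_on generalizing w p q with
  | _ n ih =>
  have hP (k : ℕ) (hk : k < n) : IsWeightedHomogeneous w (PB k).1 p := (ih k hk w p q h).1
  have hb (k : ℕ) (hk : k < n) : IsWeightedHomogeneous w (PB k).2 0 := (ih k hk w p q h).2
  have hcP (k : ℕ) (hk : k < n) : IsWeightedHomogeneous w (conj (PB k).1) q :=
    isWeightedHomogeneous_conj (ih k hk _ q p h.conj).1
  have hX (e : Elem) {i : M} (hi : w e = i) : IsWeightedHomogeneous w (X e : EPoly) i :=
    hi ▸ isWeightedHomogeneous_X _ _ _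
  have hXp (e : Elem) (k : ℕ) : IsWeightedHomogeneous w (X e ^ k : EPoly) (k • w e) :=
    (isWeightedHomogeneous_X _ _ _).pow k
  have sub {x y : EPoly} {i : M} (hx : IsWeightedHomogeneous w x i)
      (hy : IsWeightedHomogeneous w y i) : IsWeightedHomogeneous w (x - y) i :=
    (weightedHomogeneousSubmodule ℚ w i).sub_mem hx hy
  have neg {x : EPoly} {i : M} (hx : IsWeightedHomogeneous w x i) :
      IsWeightedHomogeneous w (-x) i :=
    (weightedHomogeneousSubmodule ℚ w i).neg_mem hx
  have cast {x : EPoly} {i j : M} (hx : IsWeightedHomogeneous w x i) (hij : i = j) :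
      IsWeightedHomogeneous w x j := hij ▸ hx
  have hC : IsWeightedHomogeneous w (C (1 / 2) : EPoly) 0 := isWeightedHomogeneous_C _ _
  obtain ⟨h, -⟩ := h
  match n with
  | 0 =>
    rw [PB]
    exact ⟨isWeightedHomogeneous_zero _ _ _, isWeightedHomogeneous_zero _ _ _⟩
  | 1 =>
    rw [PB]
    exact ⟨(neg (hX _ h.sigP)).add (cast ((hX _ rfl).mul (hX _ rfl)) h.spP),
      isWeightedHomogeneous_zero _ _ _⟩
  | n + 2 =>
    rw [PB]
    constructor
    · refine IsWeightedHomogeneous.add (sub (sub (sub ?_ ?_) ?_) ?_) ?_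
      · rw [neg_mul, neg_mul, conj_f, sub_mul, sub_mul]
        exact neg (sub
          (cast (((hX _ rfl).mul (hXp _ 2)).mul (hcP _ (by omega))) h.fps)
          (cast (((hX _ rfl).mul (hXp _ 2)).mul (hcP _ (by omega))) h.fms))
      · rw [conj_g, sub_mul, sub_mul]
        exact sub
          (cast (((hX _ rfl).mul (hXp _ 2)).mul (hP _ (by omega))) h.gms)
          (cast (((hX _ rfl).mul (hXp _ 2)).mul (hP _ (by omega))) h.gps)
      · have hs : IsWeightedHomogeneous w
            (∑ j : Fin n, conj (PB (n - j)).1 * conj (PB (j + 1)).1) (q + q) :=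
          IsWeightedHomogeneous.sum _ _ _ fun j _ =>
            (hcP _ (by omega)).mul (hcP _ (by omega))
        rw [conj_d, sub_mul, sub_mul]
        exact sub (cast (((hX _ rfl).mul (hXp _ 4)).mul hs) h.dps)
          (cast (((hX _ rfl).mul (hXp _ 4)).mul hs) h.dms)
      · have hs : IsWeightedHomogeneous w
            (∑ j : Fin n, (PB (n - j)).1 * conj (PB (j + 1)).1) (p + q) :=
          IsWeightedHomogeneous.sum _ _ _ fun j _ =>
            (hP _ (by omega)).mul (hcP _ (by omega))
        -- The scalar is split off first, so that distributing over d leaves exactly the terms of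
        -- `h.dp` and `h.dm`.
        rw [mul_assoc (C (1 / 2)), mul_assoc (C (1 / 2)), mul_assoc (C (1 / 2)), d, sub_mul,
          sub_mul, sub_mul]
        exact cast (hC.mul (sub
          (cast ((((hX _ rfl).mul (hXp _ 2)).mul (hXp _ 2)).mul hs) h.dp)
          (cast ((((hX _ rfl).mul (hXp _ 2)).mul (hXp _ 2)).mul hs) h.dm))) (zero_add _)
      · exact cast (((hX _ rfl).mul (hX _ rfl)).mul (hb _ (by omega)))
          ((add_zero _).trans h.spP)
    · refine sub ?_ ?_
      · have hs : IsWeightedHomogeneous w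
            (∑ j : Fin (n + 1), conj (PB (n + 1 - j)).1 * (PB (j + 1)).1) (q + p) :=
          IsWeightedHomogeneous.sum _ _ _ fun j _ =>
            (hcP _ (by omega)).mul (hP _ (by omega))
        exact cast ((((hXp _ 2).mul (hXp _ 2)).mul (hXp _ 2)).mul hs) h.gam
      · have hs : IsWeightedHomogeneous w
            (∑ j : Fin (n + 1), (PB (n + 1 - j)).2 * (PB (j + 1)).2) (0 + 0) :=
          IsWeightedHomogeneous.sum _ _ _ fun j _ =>
            (hb _ (by omega)).mul (hb _ (by omega))
        exact cast (hC.mul hs) (by simp)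

theorem sum_smul_eq_of_mem_support {M : Type*} [AddCommGroup M] {w : Elem → M} {p q : M}
    (h : Compatible w p q) {n : ℕ} {m : Elem →₀ ℕ} (hm : m ∈ (P n).support) :
    ∑ e, m e • w e = p := by
  rw [← (isWeightedHomogeneous_PB n w p q h).1 (mem_support_iff.mp hm), Finsupp.weight_apply,
    Finsupp.sum_fintype _ _ (by simp)]

end EPoly

/-! ### Three gradings and the factors they force -/

/-- A weight that balances `Σ`, `S` against `d`, `γ`. -/
def balanceWeight : Elem → ℤ
  | .sigP => 1 | .sigM => 1 | .spP => 1 | .spM => 1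
  | .dp => -1 | .dps => -1 | .dm => -1 | .dms => -1 | .gam => -1
  | _ => 0

/-- The sum of the change of `A_3^{(2)} - S_3` and of the number of symbols `a_1`, `a_1^*`, minus
twice the number of symbols other than `a_1`, `a_1^*`, `γ`, `γ⁻¹`. -/
def helicityDegreeWeight : Elem → ℤ
  | .a1s => 2 | .sigP => -1 | .spP => -1 | .sigM => -3 | .spM => -3
  | .dp => -1 | .dm => -1 | .dps => -3 | .dms => -3
  | .fp => -2 | .fps => -2 | .fm => -2 | .fms => -2
  | .gp => -4 | .gm => -4
  | _ => 0

/-- The change of `L_0^{(2)} - A_3^{(2)} + S_3` modulo `4`. -/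
def levelHelicityWeight : Elem → ZMod 4
  | .sigP => -1 | .spP => -1 | .sigM => 1 | .spM => 1
  | .dp => -1 | .dm => -1 | .dps => 1 | .dms => 1
  | .fp => 2 | .fps => 2 | .fm => 2 | .fms => 2
  | _ => 0

/-- The extra unit in products of two P's is absorbed by d, and the two units of P*P in b_n by γ².
As γ and γ⁻¹ are independent symbols, γ⁻¹ may have weight 0. -/
theorem balanceWeight_compatible : Compatible balanceWeight 1 1 := by
  constructor <;> constructor <;> decide

/-- The degree count contributes -2 both to P_n and to its conjugate, and the change of A_3 - S_3
contributes 1 and -1 respectively. -/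
theorem helicityDegreeWeight_compatible : Compatible helicityDegreeWeight (-1) (-3) := by
  constructor <;> constructor <;> decide

/-- The level is conserved only modulo 4: the charges of f_+ and f_- differ by 4, as do those of
g'_- and g_+, and those of d_+ and d_- by 8. -/
theorem levelHelicityWeight_compatible : Compatible levelHelicityWeight (-1) 1 := by
  constructor <;> constructor <;> decide

theorem Elem.sum_univ {M : Type*} [AddCommMonoid M] (F : Elem → M) :
    ∑ e, F e = F a1 + F a1s + F dp + F dps + F dm + F dms + F fp + F fps + F fm + F fms +
      F gp + F gps + F gm + F gms + F sigP + F sigM + F spP + F spM + F gam + F gamInv := by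
  change ∑ e ∈ {a1, a1s, dp, dps, dm, dms, fp, fps, fm, fms, gp, gps, gm, gms, sigP, sigM, spP, spM,
    gam, gamInv}, F e = _
  simp [Finset.sum_insert, add_assoc]

/-- Every monomial of `P_n` contains `Σ_±` or `S_±`. -/
theorem exists_sigma_or_spin {n : ℕ} {m : Elem →₀ ℕ} (hm : m ∈ (EPoly.P n).support) :
    0 < m .sigP ∨ 0 < m .sigM ∨ 0 < m .spP ∨ 0 < m .spM := by
  have h := EPoly.sum_smul_eq_of_mem_support balanceWeight_compatible hm
  rw [Elem.sum_univ] at h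
  simp [balanceWeight] at h
  omega

/-- Every monomial of `P_n` contains `Σ_±`, `S_+` or at least two symbols `a_1^*`. -/
theorem exists_sigma_or_spP_or_two_le_a1s {n : ℕ} {m : Elem →₀ ℕ}
    (hm : m ∈ (EPoly.P n).support) :
    0 < m .sigP ∨ 0 < m .sigM ∨ 0 < m .spP ∨ 2 ≤ m .a1s := by
  by_contra! hc
  have h1 := EPoly.sum_smul_eq_of_mem_support balanceWeight_compatible hm
  have h2 := EPoly.sum_smul_eq_of_mem_support helicityDegreeWeight_compatible hm
  have h3 := EPoly.sum_smul_eq_of_mem_support levelHelicityWeight_compatible hm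
  rw [Elem.sum_univ] at h1 h2 h3
  simp [balanceWeight] at h1
  simp [helicityDegreeWeight] at h2
  -- By `h1` some S_- occurs. In `h2` only a_1^* is positive and contributes at most 2, each S_-
  -- costs 3, and the total is -1; hence there is one S_- and nothing else of negative weight.
  have e1 : m .spM = 1 := by omega
  have e2 : m .sigP = 0 ∧ m .sigM = 0 ∧ m .spP = 0 ∧ m .dp = 0 ∧ m .dps = 0 ∧ m .dm = 0 ∧
      m .dms = 0 ∧ m .fp = 0 ∧ m .fps = 0 ∧ m .fm = 0 ∧ m .fms = 0 := by omega
  obtain ⟨i1, i2, i3, i4, i5, i6, i7, i8, i9, i10, i11⟩ := e2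
  -- Only the weight 1 of S_- is left, whereas -1 is required, and these differ modulo 4.
  simp only [i1, i2, i3, i4, i5, i6, i7, i8, i9, i10, i11, e1, levelHelicityWeight] at h3
  simp at h3
  revert h3
  decide

/-! ### Nonzero matrix elements -/

/-- The matrix element `⟨b| A |b'⟩` does not vanish. -/
def Connects (A : Op) (b b' : Basis) : Prop := A (ket b') b ≠ 0

/-- A linear operator is determined by its values on the basis states, so a nonzero component must
come from some basis state present in v. -/
theorem exists_connects {A : Op} {v : Vec} {b : Basis} (h : A v b ≠ 0) :
    ∃ b', v b' ≠ 0 ∧ Connects A b b' := by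
  have hA : A = ofKets fun b' => A (ket b') := by
    refine Finsupp.lhom_ext fun b' c => ?_
    simp only [ofKets, Finsupp.linearCombination_single, ket, ← map_smul, Finsupp.smul_single,
      smul_eq_mul, mul_one]
  rw [hA] at h
  exact ofKets_apply_ne h

theorem Connects.of_mul {A B : Op} {b b'' : Basis} (h : Connects (A * B) b b'') :
    ∃ b', Connects A b b' ∧ Connects B b' b'' := by
  obtain ⟨b', h1, h2⟩ := exists_connects (A := A) (v := B (ket b'')) h
  exact ⟨b', h2, h1⟩

theorem Connects.of_smul {c : ℂ} {A : Op} {b b' : Basis} (h : Connects (c • A) b b') :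
    Connects A b b' := fun h0 => h (by simp [h0])

theorem Connects.of_opSum {ι : Type} {F : ι → Op} {b b' : Basis} (h : Connects (opSum F) b b') :
    ∃ i, Connects (F i) b b' := by
  by_contra! hc
  simp only [Connects, not_not] at hc
  apply h
  rw [opSum, ofKets_ket]
  refine finsum_induction (fun v : Vec => v b = 0) rfl (fun x y hx hy => ?_) hc
  rw [Finsupp.add_apply, hx, hy, add_zero]

theorem Connects.level_eq {δ : ℤ} {A : Op} (hA : HomOp δ A) {b b' : Basis}
    (h : Connects A b b') : (level b : ℤ) = level b' + δ :=
  hA _ _ (ket_homVec b') b h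

theorem Connects.of_diagOp {F : Basis → ℝ} {b b' : Basis} (h : Connects (diagOp F) b b') :
    b = b' := by
  refine ket_apply_ne fun h0 => h ?_
  rw [diagOp, ofKets_ket, Finsupp.smul_apply, h0, smul_zero]

/-! ### Quantum numbers of the oscillator part -/

/-- The number of quanta, `∑ n_k`. -/
def quanta (b : Basis) : ℤ := b.1.sum fun _ n => (n : ℤ)

theorem quanta_add_single (ν : Occ) (t : Spin) (k : Mode) :
    quanta (ν + Finsupp.single k 1, t) = quanta (ν, t) + 1 := by
  unfold quanta
  rw [Finsupp.sum_add_index' (by simp) (by intros; push_cast; ring),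
    Finsupp.sum_single_index (by simp)]
  simp

theorem helicity_add_single (ν : Occ) (t : Spin) (k : Mode) :
    helicity (ν + Finsupp.single k 1, t) = helicity (ν, t) + Int.sign k := by
  unfold helicity
  rw [Finsupp.sum_add_index' (by simp) (by intros; push_cast; ring),
    Finsupp.sum_single_index (by simp)]
  simp

theorem sub_add_single {ν : Occ} {k : Mode} (h : ν k ≠ 0) :
    ν - Finsupp.single k 1 + Finsupp.single k 1 = ν := by
  refine tsub_add_cancel_of_le ?_
  rw [Finsupp.single_le_iff]
  omega

theorem Connects.of_lower {k : Mode} {b b' : Basis} (h : Connects (lower k) b b') :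
    b.2 = b'.2 ∧ quanta b = quanta b' - 1 ∧ helicity b = helicity b' - Int.sign k := by
  obtain ⟨c, h1, h2, rfl⟩ := lower_apply_ne h
  obtain rfl := ket_apply_ne h1
  have h3 := quanta_add_single (c.1 - Finsupp.single k 1) c.2 k
  have h4 := helicity_add_single (c.1 - Finsupp.single k 1) c.2 k
  rw [sub_add_single h2] at h3 h4
  exact ⟨rfl, by change quanta c = _ at h3; omega, by change helicity c = _ at h4; omega⟩

theorem Connects.of_raise {k : Mode} {b b' : Basis} (h : Connects (raise k) b b') :
    b.2 = b'.2 ∧ quanta b = quanta b' + 1 ∧ helicity b = helicity b' + Int.sign k := by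
  obtain ⟨c, h1, rfl⟩ := raise_apply_ne h
  obtain rfl := ket_apply_ne h1
  exact ⟨rfl, quanta_add_single _ _ _, helicity_add_single _ _ _⟩

theorem Connects.of_a {k : ℤ} {b b' : Basis} (h : Connects (a k) b b') :
    b.2 = b'.2 ∧ quanta b = quanta b' - Int.sign k ∧ helicity b = helicity b' - 1 := by
  unfold a at h
  split_ifs at h with h1 h2
  · simpa [Int.sign_eq_one_of_pos h2] using h.of_lower
  · have h3 : k < 0 := lt_of_le_of_ne (not_lt.mp h2) h1.1
    simpa [Int.sign_eq_neg_one_of_neg h3, ← sub_eq_add_neg] using h.of_raise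
  · exact absurd rfl h

theorem Connects.of_aDag {k : ℤ} {b b' : Basis} (h : Connects (aDag k) b b') :
    b.2 = b'.2 ∧ quanta b = quanta b' + Int.sign k ∧ helicity b = helicity b' + 1 := by
  unfold aDag at h
  split_ifs at h with h1 h2
  · simpa [Int.sign_eq_one_of_pos h2] using h.of_raise
  · have h3 : k < 0 := lt_of_le_of_ne (not_lt.mp h2) h1.1
    simpa [Int.sign_eq_neg_one_of_neg h3, ← sub_eq_add_neg] using h.of_lower
  · exact absurd rfl h

/-- The number of quanta changes by sign n + sign k - sign (n + k). A change by 3 would need n and k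
of one sign and n + k of the other. The bound 3 is the gap between four quanta and one. -/
theorem Connects.of_sigmaPlus {b b' : Basis} (h : Connects SigmaPlus b b') :
    b.2 = b'.2 ∧ |quanta b - quanta b'| < 3 ∧ helicity b = helicity b' + 1 := by
  obtain ⟨⟨n, k⟩, h⟩ := h.of_opSum
  obtain ⟨c, h, h3⟩ := h.of_smul.of_mul
  obtain ⟨d, h1, h2⟩ := h.of_mul
  obtain ⟨s1, q1, e1⟩ := h1.of_aDag
  obtain ⟨s2, q2, e2⟩ := h2.of_aDag
  obtain ⟨s3, q3, e3⟩ := h3.of_a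
  refine ⟨s1.trans (s2.trans s3), ?_, by omega⟩
  simp only at q1 q2 q3
  rw [abs_lt]
  rcases lt_trichotomy n 0 with hn | hn | hn <;> rcases lt_trichotomy k 0 with hk | hk | hk <;>
    rcases lt_trichotomy (n + k) 0 with hj | hj | hj <;>
    simp only [Int.sign_eq_neg_one_of_neg, Int.sign_eq_one_of_pos, Int.sign_zero, add_zero, zero_add,
      hn, hk, hj]
      at q1 q2 q3 <;> omega

theorem Connects.of_sigmaMinus {b b' : Basis} (h : Connects SigmaMinus b b') :
    b.2 = b'.2 ∧ |quanta b - quanta b'| < 3 ∧ helicity b = helicity b' - 1 := by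
  obtain ⟨⟨n, k⟩, h⟩ := h.of_opSum
  obtain ⟨c, h, h3⟩ := h.of_smul.of_mul
  obtain ⟨d, h1, h2⟩ := h.of_mul
  obtain ⟨s1, q1, e1⟩ := h1.of_a
  obtain ⟨s2, q2, e2⟩ := h2.of_a
  obtain ⟨s3, q3, e3⟩ := h3.of_aDag
  refine ⟨s1.trans (s2.trans s3), ?_, by omega⟩
  simp only at q1 q2 q3
  rw [abs_lt]
  rcases lt_trichotomy n 0 with hn | hn | hn <;> rcases lt_trichotomy k 0 with hk | hk | hk <;>
    rcases lt_trichotomy (n + k) 0 with hj | hj | hj <;>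
    simp only [Int.sign_eq_neg_one_of_neg, Int.sign_eq_one_of_pos, Int.sign_zero, add_zero, zero_add,
      hn, hk, hj]
      at q1 q2 q3 <;> omega

/-! ### Spin -/

theorem Connects.of_spinPlus {b b' : Basis} (h : Connects spinPlus b b') :
    b.1 = b'.1 ∧ b.2.S = b'.2.S ∧ b.2.low = b'.2.low - 1 := by
  unfold Connects spinPlus at h
  rw [ofKets_ket] at h
  unfold ketLow at h
  split_ifs at h with h1
  · rw [ket_apply_ne (b := (b'.1, ⟨b'.2.S, b'.2.low - 1, b'.2.up, h1, b'.2.hup⟩)) (b' := b)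
      fun h0 => h (by rw [Finsupp.smul_apply, h0, smul_zero])]
    exact ⟨rfl, rfl, rfl⟩
  · simp at h

theorem Connects.of_spinMinus {b b' : Basis} (h : Connects spinMinus b b') :
    b.1 = b'.1 ∧ b.2.S = b'.2.S ∧ b.2.low = b'.2.low + 1 := by
  unfold Connects spinMinus at h
  rw [ofKets_ket] at h
  unfold ketLow at h
  split_ifs at h with h1
  · rw [ket_apply_ne (b := (b'.1, ⟨b'.2.S, b'.2.low + 1, b'.2.up, h1, b'.2.hup⟩)) (b' := b)
      fun h0 => h (by rw [Finsupp.smul_apply, h0, smul_zero])]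
    exact ⟨rfl, rfl, rfl⟩
  · simp at h

theorem Elem.spin_eq_of_connects {c₂ : ℝ} {e : Elem} (hP : e ≠ spP) (hM : e ≠ spM) {b b' : Basis}
    (h : Connects (e.op c₂) b b') : b.2 = b'.2 := by
  have hsmul {x : ℂ} {A : Op} (hA : ∀ b b', Connects A b b' → b.2 = b'.2) :
      ∀ b b', Connects (x • A) b b' → b.2 = b'.2 := fun b b' h => hA b b' h.of_smul
  have hmul {A B : Op} (hA : ∀ b b', Connects A b b' → b.2 = b'.2)
      (hB : ∀ b b', Connects B b b' → b.2 = b'.2) :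
      ∀ b b', Connects (A * B) b b' → b.2 = b'.2 := fun b b' h => by
    obtain ⟨c, h1, h2⟩ := h.of_mul
    exact (hA _ _ h1).trans (hB _ _ h2)
  have hsum {F : ℤ → Op} (hF : ∀ i b b', Connects (F i) b b' → b.2 = b'.2) :
      ∀ b b', Connects (opSum F) b b' → b.2 = b'.2 := fun b b' h => by
    obtain ⟨i, h⟩ := h.of_opSum
    exact hF i b b' h
  have ha (k : ℤ) (b b' : Basis) (h : Connects (a k) b b') : b.2 = b'.2 := h.of_a.1
  have haD (k : ℤ) (b b' : Basis) (h : Connects (aDag k) b b') : b.2 = b'.2 := h.of_aDag.1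
  suffices H : ∀ b b', Connects (e.op c₂) b b' → b.2 = b'.2 from H _ _ h
  clear h
  cases e
  case a1 => exact ha 1
  case a1s => exact haD 1
  case dp => exact hsmul (haD 4)
  case dps => exact hsmul (ha 4)
  case dm => exact hsmul (haD (-4))
  case dms => exact hsmul (ha (-4))
  case fp => exact hsum fun k => hsmul (hmul (ha _) (haD _))
  case fps => exact hsum fun k => hsmul (hmul (haD _) (ha _))
  case fm => exact hsum fun k => hsmul (hmul (ha _) (haD _))
  case fms => exact hsum fun k => hsmul (hmul (haD _) (ha _))
  case gp => exact hsum fun k => hsmul (hmul (ha _) (ha _))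
  case gps => exact hsum fun k => hsmul (hmul (haD _) (haD _))
  case gm =>
    refine hsum fun k => ?_
    split_ifs
    · exact fun _ _ h => absurd rfl h
    · exact hsmul (hmul (ha _) (ha _))
  case gms =>
    refine hsum fun k => ?_
    split_ifs
    · exact fun _ _ h => absurd rfl h
    · exact hsmul (hmul (haD _) (haD _))
  case sigP => exact fun _ _ h => h.of_sigmaPlus.1
  case sigM => exact fun _ _ h => h.of_sigmaMinus.1
  case spP => exact absurd rfl hP
  case spM => exact absurd rfl hM
  case gam => exact fun _ _ h => congrArg Prod.snd h.of_diagOp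
  case gamInv => exact fun _ _ h => congrArg Prod.snd h.of_diagOp

theorem Elem.spin_S_eq_of_connects {c₂ : ℝ} {e : Elem} {b b' : Basis}
    (h : Connects (e.op c₂) b b') : b.2.S = b'.2.S := by
  by_cases hP : e = spP
  · subst hP; exact h.of_spinPlus.2.1
  by_cases hM : e = spM
  · subst hM; exact h.of_spinMinus.2.1
  rw [Elem.spin_eq_of_connects hP hM h]

/-! ### Rows of monomials that vanish -/

/-- If the row condition `Q` is preserved by all factors to the left of `e₀`, and `e₀` has no
nonzero matrix element in the rows that satisfy `Q`, then these rows of the monomial vanish. -/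
theorem ordMonomial_apply_eq_zero (c₂ : ℝ) (m : Elem →₀ ℕ) (Q : Basis → Prop) (l₁ l₂ : List Elem)
    (e₀ : Elem) (hl : ∀ e ∈ l₁, 0 < m e → ∀ b b', Q b → Connects (e.op c₂) b b' → Q b')
    (he₀ : ∀ b b', Q b → ¬ Connects (e₀.op c₂) b b') (hm : 0 < m e₀) (b : Basis) (hb : Q b)
    (v : Vec) : ordMonomial c₂ (l₁ ++ e₀ :: l₂) m v b = 0 := by
  by_contra hne
  induction l₁ generalizing b with
  | nil =>
    -- One copy of `e₀` is split off on the left, where it meets the bra.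
    obtain ⟨j, hj⟩ := Nat.exists_eq_succ_of_ne_zero hm.ne'
    have h : (e₀.op c₂) (((e₀.op c₂) ^ j) (ordMonomial c₂ l₂ m v)) b ≠ 0 := by
      simpa [ordMonomial, hj, pow_succ'] using hne
    obtain ⟨b', -, h2⟩ := exists_connects h
    exact he₀ b b' hb h2
  | cons e l ih =>
    have h : ((e.op c₂) ^ m e) (ordMonomial c₂ (l ++ e₀ :: l₂) m v) b ≠ 0 := by
      simpa [ordMonomial] using hne
    -- The factor enters as a power, so `Q` is carried through its copies one at a time.
    have hpow : ∀ j ≤ m e, ∀ w : Vec, ∀ b, Q b → ((e.op c₂) ^ j) w b ≠ 0 →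
        ∃ b', Q b' ∧ w b' ≠ 0 := by
      intro j
      induction j with
      | zero => exact fun _ w b hb h => ⟨b, hb, by simpa using h⟩
      | succ j ihj =>
        intro hj w b hb h
        rw [pow_succ', Module.End.mul_apply] at h
        obtain ⟨b', h1, h2⟩ := exists_connects h
        exact ihj (by omega) w b' (hl e (by simp) (by omega) b b' hb h2) h1
    obtain ⟨b', h1, h2⟩ := hpow _ le_rfl _ b hb h
    exact ih (fun e he => hl e (List.mem_cons_of_mem _ he)) b' h1 h2

/-! ### States of low level -/

theorem mul_le_level (b : Basis) (k : Mode) : (k : ℤ).natAbs * b.1 k ≤ level b := by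
  by_cases h : b.1 k = 0
  · simp [h]
  · exact Finset.single_le_sum (f := fun k : Mode => (k : ℤ).natAbs * b.1 k)
      (fun _ _ => Nat.zero_le _) (Finsupp.mem_support_iff.mpr h)

theorem natAbs_le_level {b : Basis} {k : Mode} (h : b.1 k ≠ 0) : (k : ℤ).natAbs ≤ level b :=
  (Nat.le_mul_of_pos_right _ (Nat.pos_of_ne_zero h)).trans (mul_le_level b k)

theorem occ_eq_zero_of_level_eq_zero {b : Basis} (h : level b = 0) : b.1 = 0 := by
  ext k
  by_contra hk
  have h1 := natAbs_le_level hk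
  have h2 := k.2.1
  omega

/-- If only odd modes are occupied, the helicity and the level have the same parity. -/
theorem two_dvd_level_sub_helicity {b : Basis} (h : ∀ k : Mode, b.1 k ≠ 0 → ¬ (2 : ℤ) ∣ k) :
    (2 : ℤ) ∣ level b - helicity b := by
  unfold level helicity Finsupp.sum
  push_cast
  rw [← Finset.sum_sub_distrib]
  refine Finset.dvd_sum fun k hk => ?_
  rw [← sub_mul]
  refine Dvd.dvd.mul_right ?_ _
  have h1 := h k (Finsupp.mem_support_iff.mp hk)
  rcases lt_trichotomy (k : ℤ) 0 with h2 | h2 | h2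
  · rw [Int.sign_eq_neg_one_of_neg h2, abs_of_neg h2]; omega
  · exact absurd h2 k.2.1
  · rw [Int.sign_eq_one_of_pos h2, abs_of_pos h2]; omega

/-- Without 0 and ±2, the smallest even modes are ±4, and a quantum there already costs level 4. -/
theorem not_two_dvd_of_level_le {b : Basis} (h : level b ≤ 3) (k : Mode) (hk : b.1 k ≠ 0) :
    ¬ (2 : ℤ) ∣ k := by
  have h1 := natAbs_le_level hk
  obtain ⟨h2, h3, h4⟩ := k.2
  omega

/-- A state of level `4` with an occupied even mode contains a single quantum. -/
theorem quanta_eq_one {b : Basis} (h : level b = 4) {k : Mode} (hk : b.1 k ≠ 0)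
    (h2 : (2 : ℤ) ∣ k) : quanta b = 1 := by
  have h3 := natAbs_le_level hk
  have h4 := level_sub_single b.1 b.2 k hk
  obtain ⟨h5, h6, h7⟩ := k.2
  -- An even mode with |k| ≤ 4 is ±4, so one quantum exhausts the level.
  have h8 : level (b.1 - Finsupp.single k 1, b.2) = 0 := by
    change level b = _ at h4
    omega
  have h9 := quanta_add_single (b.1 - Finsupp.single k 1) b.2 k
  rw [sub_add_single hk] at h9
  change quanta b = _ at h9
  rw [h9, quanta, occ_eq_zero_of_level_eq_zero h8]
  simp

/-! ### Quantum numbers of explicit occupation states -/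

theorem level_add (μ ν : Occ) (t : Spin) : level (μ + ν, t) = level (μ, t) + level (ν, t) :=
  Finsupp.sum_add_index' (by simp) (by intros; ring)

theorem quanta_add (μ ν : Occ) (t : Spin) : quanta (μ + ν, t) = quanta (μ, t) + quanta (ν, t) :=
  Finsupp.sum_add_index' (by simp) (by intros; push_cast; ring)

theorem helicity_add (μ ν : Occ) (t : Spin) :
    helicity (μ + ν, t) = helicity (μ, t) + helicity (ν, t) :=
  Finsupp.sum_add_index' (by simp) (by intros; push_cast; ring)

theorem level_occ {k : ℤ} (hk : IsMode k) (n : ℕ) (t : Spin) :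
    level (occ k n, t) = k.natAbs * n := by
  rw [occ, dif_pos hk, level, Finsupp.sum_single_index (by simp)]

theorem quanta_occ {k : ℤ} (hk : IsMode k) (n : ℕ) (t : Spin) : quanta (occ k n, t) = n := by
  rw [occ, dif_pos hk, quanta, Finsupp.sum_single_index (by simp)]

theorem helicity_occ {k : ℤ} (hk : IsMode k) (n : ℕ) (t : Spin) :
    helicity (occ k n, t) = k.sign * n := by
  rw [occ, dif_pos hk, helicity, Finsupp.sum_single_index (by simp)]

theorem isMode_one : IsMode 1 := ⟨by decide, by decide, by decide⟩

theorem isMode_neg_one : IsMode (-1) := ⟨by decide, by decide, by decide⟩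

theorem isMode_three : IsMode 3 := ⟨by decide, by decide, by decide⟩

/-! ### Bras annihilated by Σ_± -/

/-- The states of level at most `3` and the state `|2_1 2_{-1}⟩`, which are annihilated
by `Σ_±`. -/
def SigmaNull (b : Basis) : Prop := level b ≤ 3 ∨ b.1 = occ 1 2 + occ (-1) 2

theorem level_quanta_of_eq {b : Basis} (h : b.1 = occ 1 2 + occ (-1) 2) :
    level b = 4 ∧ quanta b = 4 ∧ helicity b = 0 := by
  obtain ⟨ν, t⟩ := b
  simp only at h
  subst h
  simp [level_add, quanta_add, helicity_add, level_occ isMode_one, level_occ isMode_neg_one,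
    quanta_occ isMode_one, quanta_occ isMode_neg_one, helicity_occ isMode_one,
    helicity_occ isMode_neg_one]

/-- Both helicities have the parity of the common level. At level 4 this could fail only if `b'` had
an occupied even mode, hence a single quantum, which `hq` forbids. -/
theorem SigmaNull.two_dvd {b b' : Basis} (h : SigmaNull b) (hl : level b = level b')
    (hq : |quanta b - quanta b'| < 3) : (2 : ℤ) ∣ helicity b - helicity b' := by
  rcases h with h | h
  · have h1 := two_dvd_level_sub_helicity (not_two_dvd_of_level_le h)
    have h2 := two_dvd_level_sub_helicity (not_two_dvd_of_level_le (hl ▸ h))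
    omega
  · obtain ⟨h1, h2, h3⟩ := level_quanta_of_eq h
    have h4 := two_dvd_level_sub_helicity (b := b') fun k hk hd => by
      rw [h2, quanta_eq_one (hl ▸ h1) hk hd] at hq
      norm_num at hq
    omega

theorem SigmaNull.not_connects {b : Basis} (h : SigmaNull b) (c₂ : ℝ) {e : Elem}
    (he : e = .sigP ∨ e = .sigM) (b' : Basis) : ¬ Connects (e.op c₂) b b' := by
  intro hc
  have h1 := hc.level_eq (Elem.op_homOp c₂ e)
  rcases he with rfl | rfl
  · obtain ⟨-, h2, h3⟩ := Connects.of_sigmaPlus hc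
    have := h.two_dvd (by simpa [Elem.charge] using h1) h2
    omega
  · obtain ⟨-, h2, h3⟩ := Connects.of_sigmaMinus hc
    have := h.two_dvd (by simpa [Elem.charge] using h1) h2
    omega

/-- Read from the bra, a raising factor lowers the level, from at most 4 to at most 3. Among neutral
factors, Σ_± has no matrix element here and the others leave the occupation numbers alone. -/
theorem SigmaNull.of_connects {b b' : Basis} (h : SigmaNull b) {c₂ : ℝ} {e : Elem}
    (he : 0 ≤ e.charge) (hc : Connects (e.op c₂) b b') : SigmaNull b' := by
  have h1 := hc.level_eq (Elem.op_homOp c₂ e)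
  have h2 : level b ≤ 4 := by
    rcases h with h | h
    · omega
    · exact (level_quanta_of_eq h).1.le
  rcases he.lt_or_eq with h3 | h3
  · left; omega
  · have h4 : e = .sigP ∨ e = .sigM ∨ b.1 = b'.1 := by
      cases e <;> first | exact absurd h3 (by decide) | skip
      · exact Or.inl rfl
      · exact Or.inr (Or.inl rfl)
      · exact Or.inr (Or.inr (Connects.of_spinPlus hc).1)
      · exact Or.inr (Or.inr (Connects.of_spinMinus hc).1)
      · exact Or.inr (Or.inr (congrArg Prod.fst (Connects.of_diagOp hc)))
      · exact Or.inr (Or.inr (congrArg Prod.fst (Connects.of_diagOp hc)))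
    rcases h4 with h4 | h4 | h4
    · exact absurd hc (h.not_connects c₂ (Or.inl h4) b')
    · exact absurd hc (h.not_connects c₂ (Or.inr h4) b')
    · exact h.imp (fun h => by omega) fun h => h4 ▸ h

/-! ### Vanishing of the ordered monomials -/

section

variable {c₂ : ℝ} {s : List Elem} {m : Elem →₀ ℕ} {b : Basis}

/-- Since Σ_± is neutral, normal order puts only factors of nonnegative charge to its left, and
these preserve `SigmaNull`. -/
theorem ordMonomial_eq_zero_of_sigma (hs : IsOrdering s) (hb : SigmaNull b) {e : Elem}
    (he : e = .sigP ∨ e = .sigM) (hm : 0 < m e) (v : Vec) : ordMonomial c₂ s m v b = 0 := by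
  obtain ⟨l₁, l₂, rfl⟩ := List.append_of_mem (hs.mem e)
  refine ordMonomial_apply_eq_zero c₂ m SigmaNull l₁ l₂ e (fun x hx _ b b' hb hc => ?_)
    (fun b b' hb => hb.not_connects c₂ he b') hm b hb v
  refine hb.of_connects ?_ hc
  have h := (List.pairwise_append.mp hs.sorted).2.2 x hx e List.mem_cons_self
  rw [← Int.sign_nonneg_iff]
  rcases he with rfl | rfl <;> exact h

/-- A matrix element of S_+ in this row would need a ket with S_3 = S + 1. As S_- stands to the
right of S_+, nothing before S_+ changes the spin labels. -/
theorem ordMonomial_eq_zero_of_spinPlus (hs : IsOrdering s) (hb : b.2.low = b.2.S)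
    (hm : 0 < m .spP) (v : Vec) : ordMonomial c₂ s m v b = 0 := by
  obtain ⟨r₁, r₂, rfl, h1, h2⟩ := List.cons_sublist_iff.mp hs.spin
  obtain ⟨l₁, l₂, rfl⟩ := List.append_of_mem h1
  have hsplit : l₁ ++ Elem.spP :: l₂ ++ r₂ = l₁ ++ Elem.spP :: (l₂ ++ r₂) := by simp
  have hkill : ∀ b b' : Basis, b.2.low = b.2.S → ¬ Connects (Elem.spP.op c₂) b b' := by
    intro b b' hb hc
    obtain ⟨-, h3, h4⟩ := Connects.of_spinPlus hc
    have h5 := (abs_le.mp b'.2.hlow).2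
    omega
  rw [hsplit]
  refine ordMonomial_apply_eq_zero c₂ m (fun b => b.2.low = b.2.S) l₁ _ _
    (fun x hx _ b b' hb hc => ?_) hkill hm b hb v
  by_cases hP : x = .spP
  · exact absurd (hP ▸ hc) (hkill b b' hb)
  -- The symbol S_- lies in `r₂`, and no symbol is listed twice.
  have hM : x ≠ .spM := by
    rintro rfl
    exact (List.nodup_append.mp hs.nodup).2.2 _ (List.mem_append_left _ hx) _
      (List.singleton_sublist.mp h2) rfl
  rw [← Elem.spin_eq_of_connects hP hM hc, hb]

/-- Every factor preserves S, and S = 0 leaves only S_3 = 0, which S_± would have to shift. -/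
theorem ordMonomial_eq_zero_of_spin_zero (hs : IsOrdering s) (hb : b.2.S = 0) {e : Elem}
    (he : e = .spP ∨ e = .spM) (hm : 0 < m e) (v : Vec) : ordMonomial c₂ s m v b = 0 := by
  obtain ⟨l₁, l₂, rfl⟩ := List.append_of_mem (hs.mem e)
  refine ordMonomial_apply_eq_zero c₂ m (fun b => b.2.S = 0) l₁ l₂ e
    (fun x _ _ b b' hb hc => (Elem.spin_S_eq_of_connects hc).symm.trans hb)
    (fun b b' hb hc => ?_) hm b hb v
  have h1 := b.2.hlow
  have h2 := b'.2.hlow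
  rw [← Elem.spin_S_eq_of_connects hc, hb] at h2
  rw [hb] at h1
  simp only [Nat.cast_zero, abs_nonpos_iff] at h1 h2
  rcases he with rfl | rfl
  · have := (Connects.of_spinPlus hc).2.2
    omega
  · have := (Connects.of_spinMinus hc).2.2
    omega

/-- The total raised by the factors is at most the level of the bra, so two factors a_1^* either
exceed it or exclude every other raising factor. In the latter case a_1^* acts on the bra first and
needs a quantum in the mode 1. -/
theorem ordMonomial_eq_zero_of_a1s (hs : IsOrdering s)
    (hb : level b ≤ 1 ∨ level b ≤ 3 ∧ b.1 ⟨1, isMode_one⟩ = 0) (hm : 2 ≤ m .a1s) (b₀ : Basis) :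
    ordMonomial c₂ s m (ket b₀) b = 0 := by
  by_contra hne
  have hbound := ((ordMonomial_bound c₂ m s hs.sorted _ _ (ket_homVec b₀)).2 b hne).1
  obtain ⟨l₁, l₂, rfl⟩ := List.append_of_mem (hs.mem .a1s)
  have hnonneg (l : List Elem) : ∀ x ∈ l.map fun e => max e.charge 0 * (m e : ℤ), 0 ≤ x := by
    intro x hx
    obtain ⟨e, -, rfl⟩ := List.mem_map.mp hx
    positivity
  have h1 := List.sum_nonneg (hnonneg l₁)
  have h2 := List.sum_nonneg (hnonneg l₂)
  simp only [List.map_append, List.map_cons, List.sum_append, List.sum_cons] at hbound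
  have h3 : max (Elem.charge .a1s) 0 = 1 := by decide
  rw [h3] at hbound
  -- Two factors a_1^* already raise by 2, so level at most 1 is impossible.
  obtain ⟨hb3, hb1⟩ := hb.resolve_left (by omega)
  refine hne (ordMonomial_apply_eq_zero c₂ m (fun b => b.1 ⟨1, isMode_one⟩ = 0) l₁ l₂ .a1s
    (fun e he hme => ?_) (fun b b' hb hc => ?_) (by omega) b hb1 _)
  · have h4 := List.single_le_sum (hnonneg l₁) _ (List.mem_map_of_mem he)
    have h5 := (List.pairwise_append.mp hs.sorted).2.2 e he .a1s List.mem_cons_self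
    have h6 : e ≠ .a1s := fun h => (List.nodup_append.mp hs.nodup).2.2 e he .a1s
      List.mem_cons_self h
    -- Only a_1^* has charge 1. Any other raising symbol present would bring the total to at least
    -- 4, against level at most 3.
    have h7 : 2 ≤ max e.charge 0 := by
      revert h5 h6
      cases e <;> decide
    have h8 : (2 : ℤ) * 1 ≤ max e.charge 0 * (m e : ℤ) :=
      mul_le_mul h7 (by exact_mod_cast hme) (by norm_num) (by omega)
    omega
  · have hraise : aDag 1 = raise ⟨1, isMode_one⟩ := by
      rw [aDag, dif_pos isMode_one, if_pos one_pos]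
    change aDag 1 (ket b') b ≠ 0 at hc
    rw [hraise] at hc
    obtain ⟨c, -, rfl⟩ := raise_apply_ne hc
    simp at hb

/-- The rows of `:P_n:` vanish at the states with `S = 0` that are annihilated by `Σ_±`, and at the
states with `S_3 = S` of low level that allow at most one factor `a_1⁺`. -/
theorem ordered_P_apply_eq_zero (hs : IsOrdering s)
    (hb : b.2.S = 0 ∧ SigmaNull b ∨ b.2.low = b.2.S ∧
      (level b ≤ 1 ∨ level b ≤ 3 ∧ b.1 ⟨1, isMode_one⟩ = 0))
    (n : ℕ) (b₀ : Basis) : ordered c₂ s (EPoly.P n) (ket b₀) b = 0 := by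
  unfold ordered
  rw [LinearMap.sum_apply, Finsupp.finsetSum_apply]
  refine Finset.sum_eq_zero fun m hm => ?_
  suffices h : ordMonomial c₂ s m (ket b₀) b = 0 by simp [h]
  rcases hb with ⟨hS, hb⟩ | ⟨hS, hb⟩
  · rcases exists_sigma_or_spin hm with h | h | h | h
    · exact ordMonomial_eq_zero_of_sigma hs hb (Or.inl rfl) h _
    · exact ordMonomial_eq_zero_of_sigma hs hb (Or.inr rfl) h _
    · exact ordMonomial_eq_zero_of_spin_zero hs hS (Or.inl rfl) h _
    · exact ordMonomial_eq_zero_of_spin_zero hs hS (Or.inr rfl) h _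
  · have hb3 : SigmaNull b := Or.inl (by omega)
    rcases exists_sigma_or_spP_or_two_le_a1s hm with h | h | h | h
    · exact ordMonomial_eq_zero_of_sigma hs hb3 (Or.inl rfl) h _
    · exact ordMonomial_eq_zero_of_sigma hs hb3 (Or.inr rfl) h _
    · exact ordMonomial_eq_zero_of_spinPlus hs hS h _
    · exact ordMonomial_eq_zero_of_a1s hs hb h _

end

/-! ### The states of the table -/

/-- The exceptional alternative of `SigmaNull` serves |2_1 2_{-1}⟩ alone. Of the rows with S = 1,
|1_1⟩ has level 1 and |1_3⟩ has an empty mode 1. -/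
theorem table_apply {N S : ℕ} {ν : Occ} (h : (N, S, ν) ∈ table) (M : ℤ) (hM : |M| ≤ (S : ℤ)) :
    level (topState ν S M hM) = N ∧ helicity (topState ν S M hM) = S ∧
      (S = 0 ∧ SigmaNull (topState ν S M hM) ∨
        (level (topState ν S M hM) ≤ 1 ∨
          level (topState ν S M hM) ≤ 3 ∧ ν ⟨1, isMode_one⟩ = 0)) := by
  have h0 (t : Spin) : level (0, t) = 0 ∧ helicity (0, t) = 0 := by
    simp [level, helicity]
  simp only [table, List.mem_cons, Prod.mk.injEq, List.not_mem_nil, or_false] at h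
  unfold SigmaNull topState
  rcases h with ⟨rfl, rfl, rfl⟩ | ⟨rfl, rfl, rfl⟩ | ⟨rfl, rfl, rfl⟩ | ⟨rfl, rfl, rfl⟩ |
    ⟨rfl, rfl, rfl⟩
  · simp [h0]
  · simp [level_add, helicity_add, level_occ isMode_one, level_occ isMode_neg_one,
      helicity_occ isMode_one, helicity_occ isMode_neg_one]
  · simp [level_add, helicity_add, level_occ isMode_one, level_occ isMode_neg_one,
      helicity_occ isMode_one, helicity_occ isMode_neg_one]
  · simp [level_occ isMode_one, helicity_occ isMode_one]
  · refine ⟨?_, ?_, Or.inr (Or.inr ⟨?_, ?_⟩)⟩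
    · simp [level_occ isMode_three]
    · simp [helicity_occ isMode_three]
    · simp [level_occ isMode_three]
    · rw [occ, dif_pos isMode_three, Finsupp.single_apply_eq_zero]
      simp

/-! ### Spin eigenvalues at S_3 = S -/

theorem diagOp_ket (F : Basis → ℝ) (b : Basis) : diagOp F (ket b) = (F b : ℂ) • ket b :=
  ofKets_ket _ b

theorem spinMinus_topState (ν : Occ) (S : ℕ) (M : ℤ) (hM : |M| ≤ (S : ℤ)) :
    spinMinus (ket (topState ν S M hM)) = 0 := by
  have h : ketLow (topState ν S M hM) (S + 1) = 0 :=
    dif_neg fun h => by have := (abs_le.mp h).2; simp [topState] at this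
  rw [spinMinus, ofKets_ket]
  change (_ : ℂ) • ketLow (topState ν S M hM) (S + 1) = 0
  rw [h, smul_zero]

theorem spinMinus_spinPlus_topState (ν : Occ) (S : ℕ) (M : ℤ) (hM : |M| ≤ (S : ℤ)) :
    spinMinus (spinPlus (ket (topState ν S M hM))) =
      (2 * S : ℂ) • ket (topState ν S M hM) := by
  rw [spinPlus, ofKets_ket]
  -- For S = 0 there is no state with S_3 = S - 1 and `h1` fails, but both sides vanish.
  rcases Nat.eq_zero_or_pos S with rfl | hS
  · simp [topState]
  have h1 : |(S : ℤ) - 1| ≤ (S : ℤ) := by rw [abs_le]; omega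
  have h2 : |(S : ℤ) - 1 + 1| ≤ (S : ℤ) := by rw [abs_le]; omega
  have h3 : ketLow (topState ν S M hM) (S - 1) = ket (ν, ⟨S, S - 1, M, h1, hM⟩) := dif_pos h1
  rw [map_smul]
  change (_ : ℂ) • spinMinus (ketLow (topState ν S M hM) (S - 1)) = _
  rw [h3, spinMinus, ofKets_ket]
  have h4 : ketLow (ν, ⟨S, S - 1, M, h1, hM⟩) (S - 1 + 1) = ket (topState ν S M hM) := by
    rw [ketLow, dif_pos h2]
    simp [topState]
  rw [h4, smul_smul, ← Complex.ofReal_mul]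
  congr 1
  -- Both radicands, for the step down and the step back up, equal 2S.
  have h5 : ((topState ν S M hM).2.S : ℝ) * ((topState ν S M hM).2.S + 1) -
      (topState ν S M hM).2.low * ((topState ν S M hM).2.low - 1) = 2 * S := by
    simp only [topState]; push_cast; ring
  rw [h5]
  push_cast
  rw [show (S : ℝ) * (S + 1) - (S - 1) * (S - 1 + 1) = 2 * S by ring, ← Complex.ofReal_mul,
    Real.mul_self_sqrt (by positivity)]
  push_cast
  ring

/-- S_- kills the top state, so what remains is S² + ½ · 2S. -/
theorem spinSq_topState (ν : Occ) (S : ℕ) (M : ℤ) (hM : |M| ≤ (S : ℤ)) :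
    spinSq (ket (topState ν S M hM)) = ((S : ℂ) * (S + 1)) • ket (topState ν S M hM) := by
  have h3 : spin3 (ket (topState ν S M hM)) = (S : ℂ) • ket (topState ν S M hM) := by
    rw [spin3, diagOp_ket]
    simp [topState]
  simp only [spinSq, LinearMap.add_apply, LinearMap.smul_apply, Module.End.mul_apply, h3, map_smul,
    spinMinus_topState, map_zero, zero_add, spinMinus_spinPlus_topState, smul_smul, ← add_smul]
  congr 1
  ring

/-- Hermitian conjugation turns the column of α_2⁺ at b into row b of α_2, each term of which
carries a row of some :P_n:. -/
theorem maps_alpha2Dag_zero {c₁ c₂ : ℝ} {s : List Elem} {b : Basis}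
    (h : ∀ n b₀, ordered c₂ s (EPoly.P n) (ket b₀) b = 0) :
    Maps (alpha2Dag c₁ c₂ s) (ket b) 0 := by
  intro b₀
  have h0 : alpha2Dag c₁ c₂ s b₀ b = 0 := by
    simp [alpha2Dag, alpha2, alpha2Term, h]
  have hz : (fun b' => alpha2Dag c₁ c₂ s b₀ b' * ket b b') = fun _ => 0 := by
    funext b'
    by_cases hb : ket b b' = 0
    · rw [hb, mul_zero]
    · rw [ket_apply_ne hb, h0, zero_mul]
  rw [hz]
  exact hasSum_zero

end LCString

theorem lemma6 (c₁ c₂ : ℝ) (hc₁ : ∀ m : ℕ, (m : ℝ) + c₁ ≠ 0) (hc₂ : 0 < c₂)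
    (s : List LCString.Elem) (hs : LCString.IsOrdering s)
    (N S : ℕ) (ν : LCString.Occ) (hrow : (N, S, ν) ∈ LCString.table)
    (M : ℤ) (hM : |M| ≤ (S : ℤ)) :
    LCString.L0 (LCString.ket (LCString.topState ν S M hM)) =
        (N : ℂ) • LCString.ket (LCString.topState ν S M hM) ∧
      LCString.A3 (LCString.ket (LCString.topState ν S M hM)) =
        (S : ℂ) • LCString.ket (LCString.topState ν S M hM) ∧
      LCString.spin3 (LCString.ket (LCString.topState ν S M hM)) =
        (S : ℂ) • LCString.ket (LCString.topState ν S M hM) ∧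
      LCString.spinSq (LCString.ket (LCString.topState ν S M hM)) =
        ((S : ℂ) * (S + 1)) • LCString.ket (LCString.topState ν S M hM) ∧
      LCString.Maps (LCString.alpha2Dag c₁ c₂ s)
        (LCString.ket (LCString.topState ν S M hM)) 0 ∧
      LCString.MassSqMaps c₁ c₂ 0 s (LCString.ket (LCString.topState ν S M hM))
        (fun b => (N : ℂ) * LCString.ket (LCString.topState ν S M hM) b) := by
  obtain ⟨hlevel, hhel, hcase⟩ := LCString.table_apply hrow M hM
  have hmaps : LCString.Maps (LCString.alpha2Dag c₁ c₂ s)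
      (LCString.ket (LCString.topState ν S M hM)) 0 :=
    LCString.maps_alpha2Dag_zero (LCString.ordered_P_apply_eq_zero hs
      (hcase.imp id fun h => ⟨rfl, h⟩))
  -- The two zeros are the vectors α_2⁺|b⟩ and α_2α_2⁺|b⟩ required by `MassSqMaps`.
  refine ⟨?_, ?_, ?_, LCString.spinSq_topState ν S M hM, hmaps, 0, 0, hmaps, ?_, ?_⟩
  · rw [LCString.L0, LCString.diagOp_ket, hlevel]
    simp
  · rw [LCString.A3, LCString.diagOp_ket, hhel]
    simp
  · rw [LCString.spin3, LCString.diagOp_ket]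
    simp [LCString.topState]
  · intro b
    simp
  · funext b
    by_cases hb : LCString.ket (LCString.topState ν S M hM) b = 0
    · simp [hb]
    · rw [LCString.ket_apply_ne hb, hlevel]
      simp
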